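/- **Setting.** A literal over the Boolean variables $x_1,\dots,x_n$ is some $x_j$ or $\bar x_j$. $\Omega_k(n,m)$ is the set of ordered $m$-tuples $\Phi=(\Phi_1,\dots,\Phi_m)$ of clauses, each an ordered $k$-tuple $(\Phi_{i,1},\dots,\Phi_{i,k})$ of literals, repetitions allowed, and $\Phi_k(n,m)$ is the uniform distribution on $\Omega_k(n,m)$. The factor graph of $\Phi$ is the bipartite multigraph $G$ with variable vertices $v_1,\dots,v_n$, clause vertices $c_1,\dots,c_m$, and, for every $(i,j)\in[m]\times[k]$, one edge joining $c_i$ to the vertex of the variable of $\Phi_{i,j}$; its polarity $\rho$ is $\mathtt T$ if the literal $\Phi_{i,j}$ is a variable and $\mathtt F$ if it is a negated variable. So $V_G\cup E_G$ is identified with the fixed set $[n]\sqcup[m]\sqcup([m]\times[k])$. Let $(\Omega,\mathbb P)$ be a probability space. A rooted decorated bipartite graph $(v,G,\rho,\varphi)$ is a bipartite multigraph $G$ (with distinguished variable and clause sides) with a root $v\in V_G$ and maps $\rho:E_G\to\{\mathtt T,\mathtt F\}$, $\varphi:V_G\cup E_G\to\Omega$. Its $r$-neighborhood consists of the vertices reachable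 from $v$ by a path of length at most $r$ and the edges on those paths, with the restrictions of $\rho,\varphi$. A function $g$ of rooted decorated bipartite graphs with values in $\{\mathtt T,\mathtt F\}$ is $r$-local if its value depends only on the isomorphism class of the $r$-neighborhood of the root (isomorphisms preserve root, sides, incidence, $\rho$, $\varphi$). We assume that, for every fixed finite $(v,G,\rho)$, it is measurable in $\varphi$. The $r$-local algorithm $\mathcal A_g$ draws $\varphi\sim\mathbb P^{\otimes(V_G\cup E_G)}$ independently of $\Phi$ (its internal randomness) and outputs $\mathcal A_g(\Phi)=\big(g(v_i,G,\rho,\varphi)\big)_{i\in[n]}\in\{\mathtt T,\mathtt F\}^n$. Identify $\Phi$ with its one-hot encoding in $\{0,1\}^N$, $N=m\cdot k\cdot 2n$, whose entries are the indicators that $\Phi_{i,j}$ equals a given literal. A random degree-$D$ polynomial is a map $f:\mathbb R^N\times\Omega'\to\mathbb R^n$, for some probability space $(\Omega',\mathbb P')$, such that for each $\omega\in\Omega'$ all $n$ coordinates of $f(\cdot,\omega)$ are real polynomials of degree at most $D$ (and $f(x,\cdot)$ is measurable for each $x$); $\omega\sim\mathbb P'$ is its internal randomness and is independent of $\Phi$.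 Let $\mathtt{strictRound}(1)=\mathtt T$, $\mathtt{strictRound}(-1)=\mathtt F$ and $\mathtt{strictRound}(x)=\mathtt{err}$ for all other real $x$, applied coordinatewise to vectors. Let $\Delta(x,y)=\frac1n|\{i\in[n]:x_i\ne y_i\}|$ for $x,y\in\{\mathtt T,\mathtt F,\mathtt{err}\}^n$. **Proposition.** Let $k,r$ be natural numbers, $\alpha$ and $\eta$ real numbers with $\alpha k\ge 2$, $k-1\ge 2$, $\eta>0$. There exist $D\in\mathbb N$, $D>0$, and reals $\gamma,c>0$ and $n_0\in\mathbb N$, depending only on $\alpha,k,r,\eta$, such that for every probability space $(\Omega,\mathbb P)$ and every $r$-local algorithm $\mathcal A=\mathcal A_g$ over it, the following holds for every $n$, with $m=\lfloor\alpha n\rfloor$. There is a random degree-$D$ polynomial $f:\mathbb R^N\times\Omega'\to\mathbb R^n$ such that 1. for some coupling of the internal randomness of $\mathcal A$ with that of $f$ (the coupled pair being independent of $\Phi\sim\Phi_k(n,m)$), if $n\ge n_0$, then $$\mathbb P\big[\Delta\big(\mathcal A(\Phi),\,\mathtt{strictRound}(f(\Phi,\omega))\big)\ge\eta\big]\le\exp(-c\,n^{1/3});$$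 2. $\|f(\Phi,\omega)\|_2^2$ is integrable and $\mathbb E_{\Phi,\omega}\|f(\Phi,\omega)\|_2^2\le\gamma n$. -/

import Mathlib

open MeasureTheory ProbabilityTheory

universe u

namespace RandomKSat

/-! ### Random `k`-SAT formulas -/

/-- A literal over the variables `x_0, …, x_{n-1}`: `(i, true)` is `x_i`, `(i, false)` is its
negation. There are `2 n` literals. -/
abbrev Literal (n : ℕ) : Type := Fin n × Bool

/-- `k`-CNF formulas with `m` clauses: ordered `m`-tuples of ordered `k`-tuples of literals,
repetitions allowed. -/
abbrev Formula (k n m : ℕ) : Type := Fin m → Fin k → Literal n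

/-- The random `k`-SAT distribution: the uniform distribution on all formulas. -/
noncomputable def randomFormula (k n m : ℕ) : Measure (Formula k n m) :=
  uniformOn Set.univ

/-! ### Rooted decorated bipartite graphs -/

/-- A bipartite graph with variable vertices `Va`, clause vertices `Cl` and edges `E`; parallel
edges are allowed, as in factor graphs. -/
structure BipGraph : Type 1 where
  Va : Type
  Cl : Type
  E : Type
  /-- the variable endpoint of an edge -/
  va : E → Va
  /-- the clause endpoint of an edge -/
  cl : E → Cl

/-- The vertex set of a bipartite graph. -/
abbrev BipGraph.V (G : BipGraph) : Type := G.Va ⊕ G.Cl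

/-- `G.IsWalk x es y`: the list of edges `es`, followed one after another, leads from the
vertex `x` to the vertex `y`. -/
inductive BipGraph.IsWalk (G : BipGraph) : G.V → List G.E → G.V → Prop
  | nil (x : G.V) : G.IsWalk x [] x
  | consVa (e : G.E) (es : List G.E) (y : G.V) (h : G.IsWalk (Sum.inr (G.cl e)) es y) :
      G.IsWalk (Sum.inl (G.va e)) (e :: es) y
  | consCl (e : G.E) (es : List G.E) (y : G.V) (h : G.IsWalk (Sum.inl (G.va e)) es y) :
      G.IsWalk (Sum.inr (G.cl e)) (e :: es) y

/-- The vertex `y` is reachable from `x` by a path of length at most `r`. -/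
def BipGraph.Within (G : BipGraph) (r : ℕ) (x y : G.V) : Prop :=
  ∃ es : List G.E, G.IsWalk x es y ∧ es.length ≤ r

/-- The edge `e` lies on a path of length at most `r` that starts at `x`. (As the graph is
bipartite, walks give the same edges here as walks without repeated vertices: `e` is such an edge
iff one of its endpoints is at distance less than `r` from `x`.) -/
def BipGraph.EdgeWithin (G : BipGraph) (r : ℕ) (x : G.V) (e : G.E) : Prop :=
  ∃ (es : List G.E) (y : G.V), G.IsWalk x es y ∧ es.length ≤ r ∧ e ∈ es

theorem BipGraph.within_self (G : BipGraph) (r : ℕ) (x : G.V) : G.Within r x x :=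
  ⟨[], .nil x, Nat.zero_le _⟩

theorem BipGraph.IsWalk.endpoints {G : BipGraph} {x y : G.V} {es : List G.E}
    (h : G.IsWalk x es y) {e : G.E} (he : e ∈ es) :
    (∃ es', G.IsWalk x es' (Sum.inl (G.va e)) ∧ es'.length ≤ es.length) ∧
      (∃ es', G.IsWalk x es' (Sum.inr (G.cl e)) ∧ es'.length ≤ es.length) := by
  induction h with
  | nil x => simp at he
  | consVa e' es y h ih =>
    rcases List.mem_cons.1 he with rfl | he
    · exact ⟨⟨[], .nil _, by simp⟩, ⟨[e], .consVa _ _ _ (.nil _), by simp⟩⟩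
    · obtain ⟨⟨l₁, h₁, h₁'⟩, ⟨l₂, h₂, h₂'⟩⟩ := ih he
      exact ⟨⟨e' :: l₁, .consVa _ _ _ h₁, by simpa using h₁'⟩,
        ⟨e' :: l₂, .consVa _ _ _ h₂, by simpa using h₂'⟩⟩
  | consCl e' es y h ih =>
    rcases List.mem_cons.1 he with rfl | he
    · exact ⟨⟨[e], .consCl _ _ _ (.nil _), by simp⟩, ⟨[], .nil _, by simp⟩⟩
    · obtain ⟨⟨l₁, h₁, h₁'⟩, ⟨l₂, h₂, h₂'⟩⟩ := ih he
      exact ⟨⟨e' :: l₁, .consCl _ _ _ h₁, by simpa using h₁'⟩,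
        ⟨e' :: l₂, .consCl _ _ _ h₂, by simpa using h₂'⟩⟩

theorem BipGraph.EdgeWithin.va {G : BipGraph} {r : ℕ} {x : G.V} {e : G.E}
    (h : G.EdgeWithin r x e) : G.Within r x (Sum.inl (G.va e)) := by
  obtain ⟨es, y, hw, hl, he⟩ := h
  obtain ⟨es', h', hl'⟩ := (hw.endpoints he).1
  exact ⟨es', h', hl'.trans hl⟩

theorem BipGraph.EdgeWithin.cl {G : BipGraph} {r : ℕ} {x : G.V} {e : G.E}
    (h : G.EdgeWithin r x e) : G.Within r x (Sum.inr (G.cl e)) := by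
  obtain ⟨es, y, hw, hl, he⟩ := h
  obtain ⟨es', h', hl'⟩ := (hw.endpoints he).2
  exact ⟨es', h', hl'.trans hl⟩

/-- Rooted decorated bipartite graphs `(v, G, ρ, φ)`: a root vertex, a polarity for every edge,
and a decoration in `Ω` for every vertex and every edge. -/
structure RootedGraph (Ω : Type u) : Type (max 1 u) where
  G : BipGraph
  root : G.V
  pol : G.E → Bool
  dec : G.V ⊕ G.E → Ω

/-- The `r`-neighborhood of the root, with the restricted polarities and decorations. -/
def RootedGraph.nbhd {Ω : Type u} (r : ℕ) (A : RootedGraph Ω) : RootedGraph Ω where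
  G :=
    { Va := {a : A.G.Va // A.G.Within r A.root (Sum.inl a)}
      Cl := {c : A.G.Cl // A.G.Within r A.root (Sum.inr c)}
      E := {e : A.G.E // A.G.EdgeWithin r A.root e}
      va := fun e => ⟨A.G.va e.1, e.2.va⟩
      cl := fun e => ⟨A.G.cl e.1, e.2.cl⟩ }
  root :=
    (show (x : A.G.V) → A.G.Within r A.root x →
        {a : A.G.Va // A.G.Within r A.root (Sum.inl a)} ⊕
          {c : A.G.Cl // A.G.Within r A.root (Sum.inr c)} from
      fun x => match x with
        | Sum.inl a => fun h => Sum.inl ⟨a, h⟩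
        | Sum.inr c => fun h => Sum.inr ⟨c, h⟩) A.root (A.G.within_self r A.root)
  pol := fun e => A.pol e.1
  dec := fun z => A.dec (Sum.map (Sum.map Subtype.val Subtype.val) Subtype.val z)

/-- Isomorphism of rooted decorated bipartite graphs: bijections of the two kinds of vertices and
of the edges that preserve incidence, root, polarities and decorations. -/
def RootedGraph.Isomorphic {Ω : Type u} (A B : RootedGraph Ω) : Prop :=
  ∃ (σ : A.G.Va ≃ B.G.Va) (τ : A.G.Cl ≃ B.G.Cl) (ε : A.G.E ≃ B.G.E),
    (∀ e, B.G.va (ε e) = σ (A.G.va e)) ∧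
    (∀ e, B.G.cl (ε e) = τ (A.G.cl e)) ∧
    B.root = Sum.map σ τ A.root ∧
    (∀ e, B.pol (ε e) = A.pol e) ∧
    (∀ z, B.dec (Sum.map (Sum.map σ τ) ε z) = A.dec z)

/-! ### Local functions and local algorithms -/

/-- `g` is `r`-local: its value depends only on the isomorphism class of the
`r`-neighborhood. -/
def IsLocal {Ω : Type u} {β : Type*} (r : ℕ) (g : RootedGraph Ω → β) : Prop :=
  ∀ A B : RootedGraph Ω, (A.nbhd r).Isomorphic (B.nbhd r) → g A = g B

/-- Measurability of a rule: on every finite rooted graph with polarities, the value is a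
measurable function of the decorations. -/
def IsMeasurableRule {Ω : Type u} [MeasurableSpace Ω] {β : Type*} [MeasurableSpace β]
    (g : RootedGraph Ω → β) : Prop :=
  ∀ (G : BipGraph) (v : G.V) (ρ : G.E → Bool), Finite G.Va → Finite G.Cl → Finite G.E →
    Measurable fun φ : G.V ⊕ G.E → Ω => g ⟨G, v, ρ, φ⟩

/-- The factor graph of a formula: the `j`-th literal of the clause `i` is an edge joining the
clause `i` to the variable of this literal. -/
def factorGraph {k n m : ℕ} (Φ : Formula k n m) : BipGraph where
  Va := Fin n
  Cl := Fin m
  E := Fin m × Fin k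
  va := fun e => (Φ e.1 e.2).1
  cl := fun e => e.1

/-- The vertices and edges of the factor graph of a formula (these do not depend on the
formula, only the incidence and the polarities do). -/
abbrev Node (k n m : ℕ) : Type := (Fin n ⊕ Fin m) ⊕ (Fin m × Fin k)

/-- The law of the internal randomness of a local algorithm: independent samples from `P` at all
vertices and edges. -/
noncomputable def decorationLaw {Ω : Type u} [MeasurableSpace Ω] (P : Measure Ω) (k n m : ℕ) :
    Measure (Node k n m → Ω) :=
  Measure.pi fun _ => P

/-- The local algorithm based on `g`, on the input `Φ` and with internal randomness `φ`: the
`i`-th output is `g (v_i, G, ρ, φ)`. -/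
def localAlgorithm {Ω : Type u} (g : RootedGraph Ω → Bool) {k n m : ℕ} (Φ : Formula k n m)
    (φ : Node k n m → Ω) : Fin n → Bool :=
  fun i => g ⟨factorGraph Φ, Sum.inl i, fun e => (Φ e.1 e.2).2, φ⟩

/-! ### Low degree polynomials -/

/-- The coordinates of the input of a polynomial, `m * k * (2 n)` in number. -/
abbrev InputIndex (k n m : ℕ) : Type := Fin m × Fin k × Literal n

/-- The one-hot encoding of a formula: the `(i, j, s)` entry is the indicator that the `j`-th
literal of the `i`-th clause is `s`. -/
def encode {k n m : ℕ} (Φ : Formula k n m) : InputIndex k n m → ℝ :=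
  fun t => if Φ t.1 t.2.1 = t.2.2 then 1 else 0

/-- `f` is a degree-`D` polynomial from `ℝ^ι` to `ℝ^n`. -/
def IsPolynomialMap {ι : Type*} {n : ℕ} (D : ℕ) (f : (ι → ℝ) → EuclideanSpace ℝ (Fin n)) : Prop :=
  ∀ i : Fin n, ∃ p : MvPolynomial ι ℝ, p.totalDegree ≤ D ∧ ∀ x, f x i = MvPolynomial.eval x p

/-- `f` is a random degree-`D` polynomial over the measurable space `Ω'`. -/
def IsRandomPolynomial {ι : Type*} {n : ℕ} {Ω' : Type*} [MeasurableSpace Ω'] (D : ℕ)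
    (f : (ι → ℝ) → Ω' → EuclideanSpace ℝ (Fin n)) : Prop :=
  (∀ ω, IsPolynomialMap D fun x => f x ω) ∧ ∀ x, Measurable (f x)

/-- Parsing of a real number as true (`some true`), false (`some false`) or the error symbol
(`none`). -/
noncomputable def strictRound (x : ℝ) : Option Bool :=
  if x = 1 then some true else if x = -1 then some false else none

/-- The normalized Hamming distance of two assignments with values in true, false, error. -/
noncomputable def normHamming {n : ℕ} (x y : Fin n → Option Bool) : ℝ :=
  (hammingDist x y : ℝ) / n

/-- `π` is a coupling of `μ` and `ν`. -/
def IsCoupling {X Y : Type*} [MeasurableSpace X] [MeasurableSpace Y]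
    (π : Measure (X × Y)) (μ : Measure X) (ν : Measure Y) : Prop :=
  π.map Prod.fst = μ ∧ π.map Prod.snd = ν

end RandomKSat

open RandomKSat

/-! Fix the randomness `φ` and a variable `i`. The output at `i`, read as `1` or `-1`, extends to a
function `h` of arbitrary sets `S` of coordinates of the one-hot encoding: run the rule on the graph
whose edges are the elements of `S` (`ruleOn`). Möbius inversion gives `h(T) = ∑_{S ⊆ T} ĥ(S)`, and
on an encoded formula the monomial `∏_{t ∈ S} x_t` is the indicator of `S ⊆ occurrences Φ`. So the
output is a polynomial in the encoding with coefficients `ĥ(S)`. The required `f` is its truncation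
to degree `D`, run with the same randomness `φ`.

By locality, `ĥ(S)` vanishes unless every edge of `S` is reached from `i` by a walk of length at
most `r` inside `S` (`near_of_moebiusTransform_ne_zero`). Both claims follow from this.

Accuracy: only subsets of the `r`-neighborhood contribute, so the truncation is exact wherever this
neighborhood has at most `D` edges (`rulePolynomial_encode_of_card_le`). For suitable `D` it can
fail only near variables of degree above `d`. Those variables are few by double counting. A union
bound shows that, up to exponentially small probability, no small set of variables has many
incidences (`exists_small_sets_few_incident`), so the set stays small when it grows by `r` clause
steps (`exists_degree_nearHighDegree_small`). The failure probability is even at most `exp(-n)`.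

Second moment: the surviving sets are connected to `i`. There are `O(n^s)` such sets of size `s`,
and each occurs in a random formula with probability at most `(2n)^(-s)`, so the expected number is
bounded (`sum_rootedSets_le`). Squares reduce to this because the union of two connected sets
containing the root is again connected. -/

namespace RandomKSat

/-! ### Pulling back the edges of a graph, and locality -/

/-- The graph with the same vertices as `G` and the edges of `E'`, which are read as edges of `G`
through `ε`. -/
abbrev BipGraph.pull (G : BipGraph) {E' : Type} (ε : E' → G.E) : BipGraph where
  Va := G.Va
  Cl := G.Cl
  E := E'
  va := fun e => G.va (ε e)
  cl := fun e => G.cl (ε e)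

/-- The rooted version of `BipGraph.pull`. -/
abbrev RootedGraph.pull {Ω : Type u} (A : RootedGraph Ω) {E' : Type} (ε : E' → A.G.E) :
    RootedGraph Ω where
  G := A.G.pull ε
  root := A.root
  pol := fun e => A.pol (ε e)
  dec := fun z => A.dec (Sum.map id ε z)

theorem BipGraph.IsWalk.map {G H : BipGraph} (σ : G.Va → H.Va) (τ : G.Cl → H.Cl) (ε : G.E → H.E)
    (hσ : ∀ e, H.va (ε e) = σ (G.va e)) (hτ : ∀ e, H.cl (ε e) = τ (G.cl e)) {x y : G.V}
    {es : List G.E} (h : G.IsWalk x es y) :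
    H.IsWalk (Sum.map σ τ x) (es.map ε) (Sum.map σ τ y) := by
  induction h with
  | nil x => exact .nil _
  | consVa e es y h ih =>
    rw [Sum.map_inl, ← hσ]
    rw [Sum.map_inr, ← hτ] at ih
    exact .consVa _ _ _ ih
  | consCl e es y h ih =>
    rw [Sum.map_inr, ← hτ]
    rw [Sum.map_inl, ← hσ] at ih
    exact .consCl _ _ _ ih

theorem BipGraph.isWalk_pull {G : BipGraph} {E' : Type} {ε : E' → G.E} {x y : G.V}
    {es : List E'} : BipGraph.IsWalk (G.pull ε) x es y ↔ G.IsWalk x (es.map ε) y := by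
  constructor
  · intro h
    have := BipGraph.IsWalk.map (G := G.pull ε) (H := G) id id ε (fun _ => rfl) (fun _ => rfl) h
    rwa [Sum.map_id_id] at this
  · intro h
    induction es generalizing x with
    | nil => cases h; exact BipGraph.IsWalk.nil (G := G.pull ε) _
    | cons e es ih =>
      rw [List.map_cons] at h
      cases h with
      | consVa _ _ _ h => exact BipGraph.IsWalk.consVa (G := G.pull ε) e es y (ih h)
      | consCl _ _ _ h => exact BipGraph.IsWalk.consCl (G := G.pull ε) e es y (ih h)

/-- The edge `e` lies on a walk of length at most `r` from `x` all of whose edges are in `R`. -/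
def BipGraph.EdgeWithinIn (G : BipGraph) (R : Set G.E) (r : ℕ) (x : G.V) (e : G.E) : Prop :=
  ∃ (es : List G.E) (y : G.V), G.IsWalk x es y ∧ es.length ≤ r ∧ e ∈ es ∧ ∀ e' ∈ es, e' ∈ R

/-- The vertex `y` is reachable from `x` by a walk of length at most `r` with edges in `R`. -/
def BipGraph.WithinIn (G : BipGraph) (R : Set G.E) (r : ℕ) (x y : G.V) : Prop :=
  ∃ es : List G.E, G.IsWalk x es y ∧ es.length ≤ r ∧ ∀ e' ∈ es, e' ∈ R

theorem BipGraph.EdgeWithinIn.mem {G : BipGraph} {R : Set G.E} {r : ℕ} {x : G.V} {e : G.E}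
    (h : G.EdgeWithinIn R r x e) : e ∈ R := by
  obtain ⟨es, y, -, -, he, hR⟩ := h
  exact hR e he

theorem BipGraph.EdgeWithinIn.mono {G : BipGraph} {R R' : Set G.E} (hRR : R ⊆ R') {r : ℕ}
    {x : G.V} {e : G.E} (h : G.EdgeWithinIn R r x e) : G.EdgeWithinIn R' r x e := by
  obtain ⟨es, y, hw, hl, he, hR⟩ := h
  exact ⟨es, y, hw, hl, he, fun e' he' => hRR (hR e' he')⟩

/-- A walk through `R'` witnesses the nearness of each of its own edges, so `h` puts the whole walk
inside `R`. -/
theorem BipGraph.edgeWithinIn_iff_of_subset {G : BipGraph} {R R' : Set G.E} (hRR : R ⊆ R')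
    {r : ℕ} {x : G.V} (h : ∀ e, G.EdgeWithinIn R' r x e → e ∈ R) (e : G.E) :
    G.EdgeWithinIn R r x e ↔ G.EdgeWithinIn R' r x e := by
  refine ⟨fun h => h.mono hRR, ?_⟩
  rintro ⟨es, y, hw, hl, he, hR⟩
  exact ⟨es, y, hw, hl, he, fun e' he' => h e' ⟨es, y, hw, hl, he', hR⟩⟩

theorem BipGraph.WithinIn.of_edgeWithinIn {G : BipGraph} {R R' : Set G.E} {r : ℕ} {x y : G.V}
    (h : ∀ e, G.EdgeWithinIn R r x e → G.EdgeWithinIn R' r x e)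
    (hy : G.WithinIn R r x y) : G.WithinIn R' r x y := by
  obtain ⟨es, hw, hl, hR⟩ := hy
  exact ⟨es, hw, hl, fun e' he' => (h e' ⟨es, y, hw, hl, he', hR⟩).mem⟩

theorem exists_map_eq_of_forall_mem_range {α β : Type*} {f : α → β} :
    ∀ {l : List β}, (∀ b ∈ l, b ∈ Set.range f) → ∃ l' : List α, l'.map f = l
  | [], _ => ⟨[], rfl⟩
  | b :: l, h => by
    obtain ⟨a, ha⟩ := h b (by simp)
    obtain ⟨l', hl'⟩ := exists_map_eq_of_forall_mem_range (l := l) fun c hc => h c (by simp [hc])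
    exact ⟨a :: l', by simp [ha, hl']⟩

theorem BipGraph.within_pull {G : BipGraph} {E' : Type} {ε : E' → G.E} {r : ℕ} {x y : G.V} :
    (G.pull ε).Within r x y ↔ G.WithinIn (Set.range ε) r x y := by
  constructor
  · rintro ⟨es, hw, hl⟩
    exact ⟨es.map ε, isWalk_pull.1 hw, by simpa using hl, by simp⟩
  · rintro ⟨es, hw, hl, hR⟩
    obtain ⟨es', rfl⟩ := exists_map_eq_of_forall_mem_range hR
    exact ⟨es', isWalk_pull.2 hw, by simpa using hl⟩

theorem BipGraph.edgeWithin_pull {G : BipGraph} {E' : Type} {ε : E' → G.E}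
    (hε : Function.Injective ε) {r : ℕ} {x : G.V} {e : E'} :
    (G.pull ε).EdgeWithin r x e ↔ G.EdgeWithinIn (Set.range ε) r x (ε e) := by
  constructor
  · rintro ⟨es, y, hw, hl, he⟩
    exact ⟨es.map ε, y, isWalk_pull.1 hw, by simpa using hl, List.mem_map_of_mem he, by simp⟩
  · rintro ⟨es, y, hw, hl, he, hR⟩
    obtain ⟨es', rfl⟩ := exists_map_eq_of_forall_mem_range hR
    obtain ⟨e', he', hee⟩ := List.mem_map.1 he
    exact ⟨es', y, isWalk_pull.2 hw, by simpa using hl, hε hee ▸ he'⟩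

/-- Both graphs keep the vertices of `A`, and their edges are matched through the common images in
`A.G.E`. The edge types may differ, so that sets of occurrences can be compared with the positions
of a formula. -/
theorem RootedGraph.isomorphic_nbhd_pull {Ω : Type u} (A : RootedGraph Ω) {E₁ E₂ : Type}
    {ε₁ : E₁ → A.G.E} {ε₂ : E₂ → A.G.E} (h₁ : Function.Injective ε₁)
    (h₂ : Function.Injective ε₂) {r : ℕ}
    (h : ∀ e, A.G.EdgeWithinIn (Set.range ε₁) r A.root e ↔
      A.G.EdgeWithinIn (Set.range ε₂) r A.root e) :
    ((A.pull ε₁).nbhd r).Isomorphic ((A.pull ε₂).nbhd r) := by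
  have hV : ∀ y, (A.G.pull ε₁).Within r A.root y ↔ (A.G.pull ε₂).Within r A.root y := fun y => by
    rw [BipGraph.within_pull, BipGraph.within_pull]
    exact ⟨.of_edgeWithinIn fun e => (h e).1, .of_edgeWithinIn fun e => (h e).2⟩
  let f₁ : {e : E₁ // (A.G.pull ε₁).EdgeWithin r A.root e} → A.G.E := fun e => ε₁ e.1
  let f₂ : {e : E₂ // (A.G.pull ε₂).EdgeWithin r A.root e} → A.G.E := fun e => ε₂ e.1
  have hf₁ : Function.Injective f₁ := fun a b hab => Subtype.ext (h₁ hab)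
  have hf₂ : Function.Injective f₂ := fun a b hab => Subtype.ext (h₂ hab)
  have hr₁ : Set.range f₁ = {e | A.G.EdgeWithinIn (Set.range ε₁) r A.root e} := by
    ext e
    constructor
    · rintro ⟨a, rfl⟩
      exact (BipGraph.edgeWithin_pull h₁).1 a.2
    · intro he
      obtain ⟨a, rfl⟩ := he.mem
      exact ⟨⟨a, (BipGraph.edgeWithin_pull h₁).2 he⟩, rfl⟩
  have hr₂ : Set.range f₂ = {e | A.G.EdgeWithinIn (Set.range ε₂) r A.root e} := by
    ext e
    constructor
    · rintro ⟨a, rfl⟩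
      exact (BipGraph.edgeWithin_pull h₂).1 a.2
    · intro he
      obtain ⟨a, rfl⟩ := he.mem
      exact ⟨⟨a, (BipGraph.edgeWithin_pull h₂).2 he⟩, rfl⟩
  have hr : Set.range f₁ = Set.range f₂ := by
    rw [hr₁, hr₂]; ext e; exact h e
  let ε := (Equiv.ofInjective f₁ hf₁).trans
    ((Equiv.setCongr hr).trans (Equiv.ofInjective f₂ hf₂).symm)
  have hε : ∀ e, ε₂ (ε e).1 = ε₁ e.1 := fun e =>
    Equiv.apply_ofInjective_symm hf₂ (Equiv.setCongr hr (Equiv.ofInjective f₁ hf₁ e))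
  refine ⟨Equiv.subtypeEquivRight fun a => hV (Sum.inl a),
    Equiv.subtypeEquivRight fun a => hV (Sum.inr a), ε, ?_, ?_, ?_, ?_, ?_⟩
  · intro e
    exact Subtype.ext (congrArg A.G.va (hε e))
  · intro e
    exact Subtype.ext (congrArg A.G.cl (hε e))
  · obtain ⟨G, root, pol, dec⟩ := A
    cases root <;> rfl
  · intro e
    exact congrArg A.pol (hε e)
  · rintro ((a | c) | e)
    · rfl
    · rfl
    · exact congrArg (fun e => A.dec (Sum.inr e)) (hε e)

theorem IsLocal.pull_eq {Ω : Type u} {β : Type*} {r : ℕ} {g : RootedGraph Ω → β}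
    (hg : IsLocal r g) (A : RootedGraph Ω) {E₁ E₂ : Type}
    {ε₁ : E₁ → A.G.E} {ε₂ : E₂ → A.G.E} (h₁ : Function.Injective ε₁)
    (h₂ : Function.Injective ε₂)
    (h : ∀ e, A.G.EdgeWithinIn (Set.range ε₁) r A.root e ↔
      A.G.EdgeWithinIn (Set.range ε₂) r A.root e) :
    g (A.pull ε₁) = g (A.pull ε₂) :=
  hg _ _ (A.isomorphic_nbhd_pull h₁ h₂ h)

end RandomKSat

/-! ### Möbius transform on the Boolean lattice -/

namespace Finset

variable {ι : Type*} [DecidableEq ι]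

/-- The Möbius transform of a function of finite sets. -/
def moebiusTransform (h : Finset ι → ℝ) (S : Finset ι) : ℝ :=
  ∑ T ∈ S.powerset, (-1) ^ (S \ T).card * h T

/-- Subsets of `insert e S` split according to whether they contain `e`; those that do not carry one
more sign. Thus the transform is an iterated discrete difference. -/
theorem moebiusTransform_insert (h : Finset ι → ℝ) {e : ι} {S : Finset ι} (he : e ∉ S) :
    moebiusTransform h (insert e S) =
      moebiusTransform (fun T => h (insert e T)) S - moebiusTransform h S := by
  unfold moebiusTransform
  rw [sum_powerset_insert he, sub_eq_neg_add, ← sum_neg_distrib]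
  congr 1
  · refine sum_congr rfl fun T hT => ?_
    have heT : e ∉ T := fun h => he (mem_powerset.1 hT h)
    rw [insert_sdiff_of_notMem _ heT, card_insert_of_notMem (by simp [he]), pow_succ]
    ring
  · refine sum_congr rfl fun T hT => ?_
    have : insert e S \ insert e T = S \ T := by
      ext x
      simp only [mem_sdiff, mem_insert]
      grind
    rw [this]

theorem sum_moebiusTransform (h : Finset ι → ℝ) (T : Finset ι) :
    ∑ S ∈ T.powerset, moebiusTransform h S = h T := by
  induction T using Finset.induction_on generalizing h with
  | empty => simp [moebiusTransform]
  | insert e T he ih =>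
    rw [sum_powerset_insert he, ← sum_add_distrib, ← ih fun T => h (insert e T)]
    refine sum_congr rfl fun S hS => ?_
    rw [moebiusTransform_insert h fun h => he (mem_powerset.1 hS h)]
    ring

theorem moebiusTransform_eq_zero (h : Finset ι → ℝ) {S : Finset ι} {e : ι} (he : e ∈ S)
    (hT : ∀ T, insert e T ⊆ S → h (insert e T) = h T) : moebiusTransform h S = 0 := by
  rw [← insert_erase he, moebiusTransform_insert h (notMem_erase e S), sub_eq_zero]
  refine sum_congr rfl fun T hTS => ?_
  simp only [hT T (insert_subset he ((mem_powerset.1 hTS).trans (erase_subset _ _)))]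

theorem abs_moebiusTransform_le {h : Finset ι → ℝ} (hh : ∀ T, |h T| ≤ 1) (S : Finset ι) :
    |moebiusTransform h S| ≤ 2 ^ S.card := by
  calc |moebiusTransform h S| ≤ ∑ T ∈ S.powerset, |(-1) ^ (S \ T).card * h T| :=
        abs_sum_le_sum_abs _ _
    _ ≤ ∑ T ∈ S.powerset, 1 := sum_le_sum fun T _ => by
        rw [abs_mul, abs_pow, abs_neg, abs_one, one_pow, one_mul]; exact hh T
    _ = 2 ^ S.card := by simp

end Finset

namespace RandomKSat

open Finset

variable {k n m : ℕ} {Ω : Type u}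

/-! ### The graph of all possible edges -/

/-- The bipartite graph with one edge for every possible occurrence of a literal in a clause. -/
abbrev occurrenceGraph (k n m : ℕ) : BipGraph where
  Va := Fin n
  Cl := Fin m
  E := InputIndex k n m
  va := fun t => t.2.2.1
  cl := fun t => t.1

/-- The occurrence graph with root `i` and decorations `φ`. -/
abbrev rootedOccurrenceGraph (i : Fin n) (φ : Node k n m → Ω) : RootedGraph Ω where
  G := occurrenceGraph k n m
  root := Sum.inl i
  pol := fun t => t.2.2.2
  dec := fun z => φ (Sum.map id (fun t => (t.1, t.2.1)) z)

/-- The occurrences of literals in a formula. -/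
def occurrences (Φ : Formula k n m) : Finset (InputIndex k n m) :=
  univ.filter fun t => Φ t.1 t.2.1 = t.2.2

theorem mem_occurrences {Φ : Formula k n m} {t : InputIndex k n m} :
    t ∈ occurrences Φ ↔ Φ t.1 t.2.1 = t.2.2 := by
  simp [occurrences]

/-- The occurrence of a literal at a position of a formula. -/
def occurrenceAt (Φ : Formula k n m) (e : Fin m × Fin k) : InputIndex k n m :=
  (e.1, e.2, Φ e.1 e.2)

theorem occurrenceAt_injective (Φ : Formula k n m) : Function.Injective (occurrenceAt Φ) := by
  rintro ⟨a, b⟩ ⟨c, d⟩ h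
  simp only [occurrenceAt, Prod.mk.injEq] at h
  exact Prod.ext h.1 h.2.1

theorem range_occurrenceAt (Φ : Formula k n m) :
    Set.range (occurrenceAt Φ) = (occurrences Φ : Set (InputIndex k n m)) := by
  ext ⟨a, b, s⟩
  simp only [Set.mem_range, occurrenceAt, mem_coe, mem_occurrences, Prod.exists, Prod.mk.injEq]
  constructor
  · rintro ⟨a, b, rfl, rfl, h⟩; exact h
  · intro h; exact ⟨a, b, rfl, rfl, h⟩

/-- The occurrence `t` lies on a walk of length at most `r` that starts at the variable `i` and
uses occurrences in `S` only. -/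
abbrev Near (S : Finset (InputIndex k n m)) (r : ℕ) (i : Fin n) (t : InputIndex k n m) : Prop :=
  (occurrenceGraph k n m).EdgeWithinIn (S : Set (InputIndex k n m)) r (Sum.inl i) t

open Classical in
/-- The occurrences in the `r`-neighborhood of the variable `i`. -/
noncomputable def nearOccurrences (S : Finset (InputIndex k n m)) (r : ℕ) (i : Fin n) :
    Finset (InputIndex k n m) :=
  S.filter (Near S r i)

theorem mem_nearOccurrences {S : Finset (InputIndex k n m)} {r : ℕ} {i : Fin n}
    {t : InputIndex k n m} : t ∈ nearOccurrences S r i ↔ Near S r i t := by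
  simp only [nearOccurrences, mem_filter, and_iff_right_iff_imp]
  exact fun h => h.mem

theorem nearOccurrences_subset (S : Finset (InputIndex k n m)) (r : ℕ) (i : Fin n) :
    nearOccurrences S r i ⊆ S :=
  fun _ ht => (mem_nearOccurrences.1 ht).mem

/-- The value `1` or `-1` of a rule on the graph with the edge set `S`. -/
def ruleOn (g : RootedGraph Ω → Bool) (i : Fin n) (φ : Node k n m → Ω)
    (S : Finset (InputIndex k n m)) : ℝ :=
  if g ((rootedOccurrenceGraph i φ).pull (Subtype.val : {t // t ∈ S} → InputIndex k n m)) then 1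
  else -1

theorem abs_ruleOn (g : RootedGraph Ω → Bool) (i : Fin n) (φ : Node k n m → Ω)
    (S : Finset (InputIndex k n m)) : |ruleOn g i φ S| ≤ 1 := by
  unfold ruleOn; split_ifs <;> simp

theorem ruleOn_eq_of_subset {r : ℕ} {g : RootedGraph Ω → Bool} (hg : IsLocal r g) (i : Fin n)
    (φ : Node k n m → Ω) {S T : Finset (InputIndex k n m)} (hST : S ⊆ T)
    (h : ∀ t, Near T r i t → t ∈ S) : ruleOn g i φ S = ruleOn g i φ T := by
  unfold ruleOn
  rw [hg.pull_eq (rootedOccurrenceGraph i φ) (ε₁ := (Subtype.val : {t // t ∈ S} → _))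
    (ε₂ := (Subtype.val : {t // t ∈ T} → _)) Subtype.val_injective Subtype.val_injective]
  intro e
  have hS : Set.range (Subtype.val : {t // t ∈ S} → InputIndex k n m) = (S : Set _) := by
    ext; simp
  have hT : Set.range (Subtype.val : {t // t ∈ T} → InputIndex k n m) = (T : Set _) := by
    ext; simp
  rw [hS, hT]
  exact BipGraph.edgeWithinIn_iff_of_subset (by exact_mod_cast hST) h e

/-- The decoration of an occurrence depends only on its position, so the pullback along
`occurrenceAt Φ` is the factor graph itself. Locality then replaces positions by the subtype of
occurrences as edge type. -/
theorem ruleOn_occurrences {r : ℕ} {g : RootedGraph Ω → Bool} (hg : IsLocal r g) (i : Fin n)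
    (φ : Node k n m → Ω) (Φ : Formula k n m) :
    ruleOn g i φ (occurrences Φ) = if localAlgorithm g Φ φ i then 1 else -1 := by
  have h1 : localAlgorithm g Φ φ i = g ((rootedOccurrenceGraph i φ).pull (occurrenceAt Φ)) := by
    unfold localAlgorithm
    congr 1
    change RootedGraph.mk _ _ _ _ = RootedGraph.mk _ _ _ _
    congr 1
    funext z
    rcases z with (v | e) <;> rfl
  unfold ruleOn
  rw [h1, hg.pull_eq (rootedOccurrenceGraph i φ)
    (ε₁ := (Subtype.val : {t // t ∈ occurrences Φ} → _))
    (ε₂ := occurrenceAt Φ) Subtype.val_injective (occurrenceAt_injective Φ)]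
  intro e
  have hS : Set.range (Subtype.val : {t // t ∈ occurrences Φ} → InputIndex k n m) =
      (occurrences Φ : Set _) := by
    ext; simp
  rw [hS, range_occurrenceAt]

/-! ### Sets of occurrences that are connected to a root -/

/-- The occurrence `t` meets the variable `i` or the set `S`. -/
def Attached (i : Fin n) (S : Finset (InputIndex k n m)) (t : InputIndex k n m) : Prop :=
  t.2.2.1 = i ∨ ∃ t' ∈ S, t'.2.2.1 = t.2.2.1 ∨ t'.1 = t.1

theorem Attached.mono {i : Fin n} {S S' : Finset (InputIndex k n m)} (h : S ⊆ S')
    {t : InputIndex k n m} (ht : Attached i S t) : Attached i S' t :=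
  ht.imp_right fun ⟨t', ht', h'⟩ => ⟨t', h ht', h'⟩

/-- The set `S` of occurrences together with the variable `i` is connected. -/
def Rooted (i : Fin n) (S : Finset (InputIndex k n m)) : Prop :=
  ∀ S' ⊂ S, ∃ t ∈ S, t ∉ S' ∧ Attached i S' t

/-- A proper subset of the union misses an element of `S` or of `T`, and the connectedness of that
set provides the next element. -/
theorem Rooted.union {i : Fin n} {S T : Finset (InputIndex k n m)} (hS : Rooted i S)
    (hT : Rooted i T) : Rooted i (S ∪ T) := by
  have key : ∀ {S U S' : Finset (InputIndex k n m)}, Rooted i S → S ⊆ U → ¬ S ⊆ S' →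
      ∃ t ∈ U, t ∉ S' ∧ Attached i S' t := by
    intro S U S' hS hSU h
    obtain ⟨t, htS, ht, hat⟩ := hS (S ∩ S') ⟨inter_subset_left, fun h' => h (subset_inter_iff.1 h').2⟩
    exact ⟨t, hSU htS, fun h' => ht (mem_inter.2 ⟨htS, h'⟩), hat.mono inter_subset_right⟩
  intro S' hS'
  by_cases h : S ⊆ S'
  · exact key hT subset_union_right fun h' => hS'.2 (union_subset h h')
  · exact key hS subset_union_left h

/-- The first edge of the walk outside `S` works: the edges before it lie in `S`. The hypothesis
`hx` allows any starting vertex touched by `S`, so that the induction can move along the walk. -/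
theorem exists_attached_of_isWalk {i : Fin n} {S : Finset (InputIndex k n m)}
    {es : List (InputIndex k n m)} {x y : (occurrenceGraph k n m).V}
    (h : (occurrenceGraph k n m).IsWalk x es y)
    (hx : x = Sum.inl i ∨ ∃ t ∈ S, x = Sum.inl t.2.2.1 ∨ x = Sum.inr t.1)
    (hes : ∃ t ∈ es, t ∉ S) : ∃ t ∈ es, t ∉ S ∧ Attached i S t := by
  induction es generalizing x with
  | nil => simp at hes
  | cons e es ih =>
    by_cases he : e ∈ S
    · have hes' : ∃ t ∈ es, t ∉ S := by
        obtain ⟨t, ht, htS⟩ := hes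
        rcases List.mem_cons.1 ht with rfl | ht
        · exact absurd he htS
        · exact ⟨t, ht, htS⟩
      have : ∃ t ∈ es, t ∉ S ∧ Attached i S t := by
        cases h with
        | consVa _ _ _ h => exact ih h (Or.inr ⟨e, he, Or.inr rfl⟩) hes'
        | consCl _ _ _ h => exact ih h (Or.inr ⟨e, he, Or.inl rfl⟩) hes'
      obtain ⟨t, ht, h⟩ := this
      exact ⟨t, List.mem_cons_of_mem _ ht, h⟩
    · refine ⟨e, by simp, he, ?_⟩
      cases h with
      | consVa _ _ _ h =>
        rcases hx with hx | ⟨t, ht, hx | hx⟩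
        · exact Or.inl (Sum.inl.inj hx)
        · exact Or.inr ⟨t, ht, Or.inl (Sum.inl.inj hx).symm⟩
        · cases hx
      | consCl _ _ _ h =>
        rcases hx with hx | ⟨t, ht, hx | hx⟩
        · cases hx
        · cases hx
        · exact Or.inr ⟨t, ht, Or.inr (Sum.inr.inj hx).symm⟩

theorem rooted_of_near {S : Finset (InputIndex k n m)} {r : ℕ} {i : Fin n}
    (h : ∀ t ∈ S, Near S r i t) : Rooted i S := by
  intro S' hS'
  obtain ⟨t, htS, ht⟩ := exists_of_ssubset hS'
  obtain ⟨es, y, hw, -, hte, hR⟩ := h t htS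
  obtain ⟨t', ht', h1, h2⟩ := exists_attached_of_isWalk hw (Or.inl rfl) ⟨t, hte, ht⟩
  exact ⟨t', hR t' ht', h1, h2⟩

/-! ### The polynomial -/

/-- An edge `t` that is not near inside `S` is not near inside any smaller set either. By locality
its removal never changes the rule, so the difference in direction `t` vanishes. -/
theorem near_of_moebiusTransform_ne_zero {r : ℕ} {g : RootedGraph Ω → Bool} (hg : IsLocal r g)
    {i : Fin n} {φ : Node k n m → Ω} {S : Finset (InputIndex k n m)}
    (h : moebiusTransform (ruleOn g i φ) S ≠ 0) : ∀ t ∈ S, Near S r i t := by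
  intro t ht
  by_contra hn
  refine h (moebiusTransform_eq_zero _ ht fun T hT => ?_)
  refine (ruleOn_eq_of_subset hg i φ (subset_insert t T) fun t' ht' => ?_).symm
  rcases mem_insert.1 (show t' ∈ insert t T by exact_mod_cast ht'.mem) with rfl | h'
  · exact absurd (ht'.mono (by exact_mod_cast hT)) hn
  · exact h'

/-- The polynomial that sums the contributions of all sets of at most `D` occurrences to the
output of a rule. -/
noncomputable def rulePolynomial (g : RootedGraph Ω → Bool) (D : ℕ) (x : InputIndex k n m → ℝ)
    (φ : Node k n m → Ω) : EuclideanSpace ℝ (Fin n) :=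
  WithLp.toLp 2 fun i => ∑ S : Finset (InputIndex k n m) with S.card ≤ D,
    moebiusTransform (ruleOn g i φ) S * ∏ t ∈ S, x t

theorem isPolynomialMap_rulePolynomial (g : RootedGraph Ω → Bool) (D : ℕ)
    (φ : Node k n m → Ω) : IsPolynomialMap D fun x => rulePolynomial g D x φ := by
  intro i
  refine ⟨∑ S : Finset (InputIndex k n m) with S.card ≤ D,
    MvPolynomial.C (moebiusTransform (ruleOn g i φ) S) * ∏ t ∈ S, MvPolynomial.X t, ?_, ?_⟩
  · refine MvPolynomial.totalDegree_finsetSum_le fun S hS => ?_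
    refine (MvPolynomial.totalDegree_mul _ _).trans ?_
    rw [MvPolynomial.totalDegree_C, zero_add]
    refine (MvPolynomial.totalDegree_finsetProd _ _).trans ?_
    simpa using hS
  · intro x
    simp [rulePolynomial]

theorem prod_encode (Φ : Formula k n m) (S : Finset (InputIndex k n m)) :
    ∏ t ∈ S, encode Φ t = if S ⊆ occurrences Φ then 1 else 0 := by
  split_ifs with h
  · refine prod_eq_one fun t ht => ?_
    rw [encode, if_pos (mem_occurrences.1 (h ht))]
  · obtain ⟨t, ht, hn⟩ := not_subset.1 h
    refine prod_eq_zero ht ?_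
    rw [encode, if_neg fun h => hn (mem_occurrences.2 h)]

theorem rulePolynomial_encode (g : RootedGraph Ω → Bool) (D : ℕ) (Φ : Formula k n m)
    (φ : Node k n m → Ω) (i : Fin n) :
    rulePolynomial g D (encode Φ) φ i =
      ∑ S ∈ (occurrences Φ).powerset with S.card ≤ D, moebiusTransform (ruleOn g i φ) S := by
  simp only [rulePolynomial, prod_encode, mul_ite, mul_one, mul_zero]
  rw [← sum_filter, filter_filter]
  refine sum_congr ?_ fun _ _ => rfl
  ext S
  simp [and_comm]

/-- By inversion the output is the sum of the coefficients over subsets of the neighborhood. All of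
these survive the truncation, and the other sets in the polynomial have coefficient zero. -/
theorem rulePolynomial_encode_of_card_le {r : ℕ} {g : RootedGraph Ω → Bool} (hg : IsLocal r g)
    {D : ℕ} (Φ : Formula k n m) (φ : Node k n m → Ω) {i : Fin n}
    (h : (nearOccurrences (occurrences Φ) r i).card ≤ D) :
    rulePolynomial g D (encode Φ) φ i = if localAlgorithm g Φ φ i then 1 else -1 := by
  rw [rulePolynomial_encode, ← ruleOn_occurrences hg,
    ← ruleOn_eq_of_subset hg i φ (S := nearOccurrences (occurrences Φ) r i)
      (nearOccurrences_subset _ _ _) (fun t => mem_nearOccurrences.2),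
    ← sum_moebiusTransform (ruleOn g i φ)]
  symm
  refine sum_subset ?_ ?_
  · intro S hS
    rw [mem_powerset] at hS
    exact mem_filter.2 ⟨mem_powerset.2 (hS.trans (nearOccurrences_subset _ _ _)), (card_le_card hS).trans h⟩
  · intro S hS hS'
    by_contra hne
    refine hS' (mem_powerset.2 fun t ht => mem_nearOccurrences.2 ?_)
    exact (near_of_moebiusTransform_ne_zero hg hne t ht).mono
      (by exact_mod_cast mem_powerset.1 (mem_filter.1 hS).1)

open Classical in
/-- The connected sets of at most `D` occurrences. -/
noncomputable def rootedSets (k m : ℕ) (D : ℕ) (i : Fin n) : Finset (Finset (InputIndex k n m)) :=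
  univ.filter fun S => S.card ≤ D ∧ Rooted i S

theorem mem_rootedSets {D : ℕ} {i : Fin n} {S : Finset (InputIndex k n m)} :
    S ∈ rootedSets k m D i ↔ S.card ≤ D ∧ Rooted i S := by
  simp [rootedSets]

theorem abs_rulePolynomial_encode_le {r : ℕ} {g : RootedGraph Ω → Bool} (hg : IsLocal r g)
    (D : ℕ) (Φ : Formula k n m) (φ : Node k n m → Ω) (i : Fin n) :
    |rulePolynomial g D (encode Φ) φ i| ≤
      2 ^ D * ((rootedSets k m D i).filter (· ⊆ occurrences Φ)).card := by
  rw [rulePolynomial_encode]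
  calc |∑ S ∈ (occurrences Φ).powerset with S.card ≤ D, moebiusTransform (ruleOn g i φ) S|
      = |∑ S ∈ (rootedSets k m D i).filter (· ⊆ occurrences Φ),
          moebiusTransform (ruleOn g i φ) S| := by
        congr 1
        symm
        refine sum_subset ?_ ?_
        · intro S hS
          rw [mem_filter, mem_rootedSets] at hS
          exact mem_filter.2 ⟨mem_powerset.2 hS.2, hS.1.1⟩
        · intro S hS hS'
          by_contra hne
          rw [mem_filter, mem_powerset] at hS
          exact hS' (mem_filter.2 ⟨mem_rootedSets.2 ⟨hS.2,
            rooted_of_near (near_of_moebiusTransform_ne_zero hg hne)⟩, hS.1⟩)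
    _ ≤ ∑ S ∈ (rootedSets k m D i).filter (· ⊆ occurrences Φ),
          |moebiusTransform (ruleOn g i φ) S| := abs_sum_le_sum_abs _ _
    _ ≤ ∑ S ∈ (rootedSets k m D i).filter (· ⊆ occurrences Φ), (2 : ℝ) ^ D := by
        refine sum_le_sum fun S hS => ?_
        refine (abs_moebiusTransform_le (abs_ruleOn g i φ) S).trans ?_
        exact pow_le_pow_right₀ (by norm_num) (mem_rootedSets.1 (mem_filter.1 hS).1).1
    _ = _ := by rw [sum_const, nsmul_eq_mul, mul_comm]

theorem measurable_rulePolynomial [MeasurableSpace Ω] {g : RootedGraph Ω → Bool}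
    (hg : IsMeasurableRule g) (D : ℕ) (x : InputIndex k n m → ℝ) :
    Measurable (rulePolynomial g D x : (Node k n m → Ω) → EuclideanSpace ℝ (Fin n)) := by
  have hrule : ∀ i S, Measurable fun φ : Node k n m → Ω => ruleOn g i φ S := by
    intro i S
    have h1 := hg ((occurrenceGraph k n m).pull (Subtype.val : {t // t ∈ S} → InputIndex k n m))
      (Sum.inl i) (fun t => t.1.2.2.2) inferInstance inferInstance inferInstance
    have h2 : Measurable fun φ : Node k n m → Ω =>
        g ((rootedOccurrenceGraph i φ).pull (Subtype.val : {t // t ∈ S} → InputIndex k n m)) :=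
      h1.comp (measurable_pi_lambda _ fun z => measurable_pi_apply (X := fun _ : Node k n m => Ω)
        (Sum.map id (fun t : InputIndex k n m => (t.1, t.2.1)) (Sum.map id Subtype.val z)))
    exact Measurable.ite (h2 (measurableSet_singleton true)) measurable_const measurable_const
  refine (WithLp.measurable_toLp 2 _).comp (measurable_pi_lambda _ fun i => ?_)
  refine Finset.measurable_sum _ fun S _ => Measurable.mul_const ?_ _
  exact Finset.measurable_sum _ fun T _ => (hrule i T).const_mul _

/-! ### Probabilities for random formulas -/

instance nonempty_literal [NeZero n] : Nonempty (Literal n) := ⟨(0, true)⟩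

instance isProbabilityMeasure_randomFormula [NeZero n] :
    IsProbabilityMeasure (randomFormula k n m) :=
  isProbabilityMeasure_uniformOn Set.finite_univ Set.univ_nonempty

theorem randomFormula_real [NeZero n] (p : Formula k n m → Prop) [DecidablePred p] :
    (randomFormula k n m).real {Φ | p Φ} =
      (univ.filter p).card / (Fintype.card (Formula k n m) : ℝ) := by
  rw [randomFormula, measureReal_def, uniformOn_univ]
  have : ({Φ | p Φ} : Set (Formula k n m)) = ((univ.filter p : Finset _) : Set _) := by
    ext; simp
  rw [this, Measure.count_apply_finset, ENNReal.toReal_div]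
  simp

theorem randomFormula_real_forall_mem [NeZero n] (I : Finset (Fin m × Fin k))
    (A : Fin m × Fin k → Finset (Literal n)) :
    (randomFormula k n m).real {Φ | ∀ e ∈ I, Φ e.1 e.2 ∈ A e} =
      ∏ e ∈ I, ((A e).card / (2 * n) : ℝ) := by
  classical
  have hn : (n : ℝ) ≠ 0 := Nat.cast_ne_zero.2 (NeZero.ne n)
  -- Positions outside `I` are unconstrained and contribute a factor `2n / (2n) = 1`.
  let A' : Fin m × Fin k → Finset (Literal n) := fun e => if e ∈ I then A e else univ
  have h1 : (univ.filter fun Φ : Formula k n m => ∀ e ∈ I, Φ e.1 e.2 ∈ A e).card =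
      (Fintype.piFinset A').card := by
    refine card_equiv (Equiv.curry (Fin m) (Fin k) (Literal n)).symm fun Φ => ?_
    simp only [mem_filter, mem_univ, true_and, Fintype.mem_piFinset, A']
    refine forall_congr' fun e => ?_
    split_ifs with h <;> simp [h, Function.uncurry]
  have h2 : Fintype.card (Formula k n m) = ∏ _e : Fin m × Fin k, 2 * n := by
    simp [Fintype.card_prod, pow_mul, mul_comm, Formula, Literal]
  rw [randomFormula_real, h1, h2, Fintype.card_piFinset]
  push_cast
  rw [← prod_div_distrib, ← prod_subset (subset_univ I)]
  · refine prod_congr rfl fun e he => ?_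
    simp [A', he]
  · intro e _ he
    simp only [A', he, if_false, card_univ, Fintype.card_prod, Fintype.card_fin,
      Fintype.card_bool]
    push_cast
    field_simp

/-- If two elements of `S` demand different literals at one position, the event is empty; otherwise
the positions are distinct and independence gives equality. -/
theorem randomFormula_real_subset_occurrences_le [NeZero n] (S : Finset (InputIndex k n m)) :
    (randomFormula k n m).real {Φ | S ⊆ occurrences Φ} ≤ (1 / (2 * n) : ℝ) ^ S.card := by
  classical
  by_cases h : ∃ Φ : Formula k n m, S ⊆ occurrences Φ
  · obtain ⟨Φ₀, h₀⟩ := h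
    have hinj : Set.InjOn (fun t : InputIndex k n m => (t.1, t.2.1)) S := by
      rintro ⟨a, b, s⟩ ht ⟨a', b', s'⟩ ht' hab
      obtain ⟨rfl, rfl⟩ := Prod.mk.inj hab
      have h1 := mem_occurrences.1 (h₀ ht)
      have h2 := mem_occurrences.1 (h₀ ht')
      simp only at h1 h2
      rw [← h1, ← h2]
    have := randomFormula_real_forall_mem (S.image fun t => (t.1, t.2.1)) fun e => {Φ₀ e.1 e.2}
    simp only [card_singleton, Nat.cast_one, prod_const] at this
    rw [card_image_of_injOn hinj] at this
    rw [← this]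
    refine measureReal_mono ?_
    intro Φ hΦ
    simp only [Set.mem_ofPred_eq, mem_image, mem_singleton]
    rintro e ⟨t, ht, rfl⟩
    exact (mem_occurrences.1 (hΦ ht)).trans (mem_occurrences.1 (h₀ ht)).symm
  · have : {Φ : Formula k n m | S ⊆ occurrences Φ} = ∅ := by
      ext Φ; simpa using fun hΦ => h ⟨Φ, hΦ⟩
    rw [this]
    simp only [measureReal_empty]
    positivity

/-! ### Counting connected sets -/

open Classical in
/-- The sets obtained from the empty set by attaching `s` occurrences one after another. -/
noncomputable def attachedSets (k m : ℕ) (i : Fin n) : ℕ → Finset (Finset (InputIndex k n m))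
  | 0 => {∅}
  | s + 1 => (attachedSets k m i s).biUnion fun S =>
      (univ.filter (Attached i S)).image fun t => insert t S

theorem card_le_of_mem_attachedSets {i : Fin n} : ∀ {s : ℕ} {S : Finset (InputIndex k n m)},
    S ∈ attachedSets k m i s → S.card ≤ s
  | 0, S, h => by
    rw [attachedSets, mem_singleton] at h
    simp [h]
  | s + 1, S, h => by
    classical
    rw [attachedSets] at h
    obtain ⟨S', hS', h⟩ := mem_biUnion.1 h
    obtain ⟨t, -, rfl⟩ := mem_image.1 h
    have := card_le_of_mem_attachedSets hS'
    grind [card_insert_le]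

theorem Rooted.mem_attachedSets {i : Fin n} {S : Finset (InputIndex k n m)} (h : Rooted i S) :
    S ∈ attachedSets k m i S.card := by
  classical
  have key : ∀ s ≤ S.card, ∃ S' ⊆ S, S'.card = s ∧ S' ∈ attachedSets k m i s := by
    intro s
    induction s with
    | zero => exact fun _ => ⟨∅, empty_subset S, rfl, by simp [attachedSets]⟩
    | succ s ih =>
      intro hs
      obtain ⟨S', hS', hc, hm⟩ := ih (by omega)
      obtain ⟨t, htS, ht, hat⟩ := h S' (Finset.ssubset_iff_subset_ne.2 ⟨hS', by rintro rfl; omega⟩)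
      refine ⟨insert t S', insert_subset htS hS', by rw [card_insert_of_notMem ht, hc], ?_⟩
      rw [attachedSets]
      refine mem_biUnion.2 ⟨S', hm, mem_image.2 ⟨t, ?_, ?_⟩⟩
      · simpa using hat
      · ext; simp
  obtain ⟨S', hS', hc, hm⟩ := key _ le_rfl
  rwa [eq_of_subset_of_card_le hS' hc.ge] at hm

-- An attached occurrence either uses `i` or a variable of `S`, with `2mk` choices for each
-- variable, or lies in a clause of `S`, with `2nk` choices for each clause.
open Classical in
theorem card_attached_le (i : Fin n) (S : Finset (InputIndex k n m)) :
    (univ.filter (Attached i S)).card ≤ (S.card + 1) * (2 * m * k + 2 * n * k) := by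
  let V : Finset (Fin n) := insert i (S.image fun t => t.2.2.1)
  let C : Finset (Fin m) := S.image fun t => t.1
  have hV : V.card ≤ S.card + 1 := (card_insert_le _ _).trans (by gcongr; exact card_image_le)
  have hC : C.card ≤ S.card + 1 := card_image_le.trans (Nat.le_succ _)
  have hsub : univ.filter (Attached i S) ⊆
      (univ ×ˢ univ ×ˢ V ×ˢ univ) ∪ (C ×ˢ univ ×ˢ univ) := by
    intro t ht
    simp only [mem_filter, mem_univ, true_and, mem_union, mem_product, and_true, V, C,
      mem_insert, mem_image] at ht ⊢
    rcases ht with h | ⟨t', ht', h | h⟩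
    · exact Or.inl (Or.inl h)
    · exact Or.inl (Or.inr ⟨t', ht', h⟩)
    · exact Or.inr ⟨t', ht', h⟩
  refine (card_le_card hsub).trans ((card_union_le _ _).trans ?_)
  simp only [card_product, card_univ, Fintype.card_fin, Fintype.card_bool, Fintype.card_prod]
  calc m * (k * (V.card * 2)) + C.card * (k * (n * 2))
      ≤ m * (k * ((S.card + 1) * 2)) + (S.card + 1) * (k * (n * 2)) := by gcongr
    _ = _ := by ring

theorem card_attachedSets_le (i : Fin n) (s : ℕ) :
    (attachedSets k m i s).card ≤ s.factorial * (2 * m * k + 2 * n * k) ^ s := by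
  classical
  induction s with
  | zero => simp [attachedSets]
  | succ s ih =>
    rw [attachedSets]
    refine card_biUnion_le.trans ?_
    calc _ ≤ ∑ S ∈ attachedSets k m i s, (s + 1) * (2 * m * k + 2 * n * k) := by
          refine sum_le_sum fun S hS => card_image_le.trans ((card_attached_le i S).trans ?_)
          gcongr
          exact card_le_of_mem_attachedSets hS
      _ = (attachedSets k m i s).card * ((s + 1) * (2 * m * k + 2 * n * k)) := by
          rw [sum_const, smul_eq_mul]
      _ ≤ (s.factorial * (2 * m * k + 2 * n * k) ^ s) * ((s + 1) * (2 * m * k + 2 * n * k)) := by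
          gcongr
      _ = _ := by rw [Nat.factorial_succ]; ring

theorem sum_comp_le_of_card_fiber_le {ι κ : Type*} [DecidableEq κ] {R : Finset ι} {T : Finset κ}
    {f : ι → κ} (hf : ∀ x ∈ R, f x ∈ T) {w c : κ → ℝ} (hw : ∀ y, 0 ≤ w y)
    (hc : ∀ y ∈ T, ((R.filter fun x => f x = y).card : ℝ) ≤ c y) :
    ∑ x ∈ R, w (f x) ≤ ∑ y ∈ T, c y * w y := by
  rw [← sum_fiberwise_of_maps_to' hf]
  refine sum_le_sum fun y hy => ?_
  rw [sum_const, nsmul_eq_mul]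
  exact mul_le_mul_of_nonneg_right (hc y hy) (hw y)

/-- The count `s! (2mk + 2nk)^s` of growth sequences meets the weight `(2n)^(-s)`, and `(2mk + 2nk)
/ (2n) ≤ αk + k`. -/
theorem sum_rootedSets_le [NeZero n] {α : ℝ} (hm : (m : ℝ) ≤ α * n) (D : ℕ) (i : Fin n) :
    ∑ S ∈ rootedSets k m D i, (1 / (2 * n) : ℝ) ^ S.card ≤
      ∑ s ∈ range (D + 1), s.factorial * (α * k + k) ^ s := by
  have hn : (0 : ℝ) < n := Nat.cast_pos.2 (NeZero.pos n)
  refine (sum_comp_le_of_card_fiber_le (R := rootedSets k m D i) (f := Finset.card)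
    (T := range (D + 1)) (w := fun s => (1 / (2 * n) : ℝ) ^ s)
    (c := fun s => s.factorial * (2 * m * k + 2 * n * k) ^ s)
    (fun S hS => mem_range.2 (Nat.lt_succ_of_le (mem_rootedSets.1 hS).1))
    (fun s => by positivity) fun s _ => ?_).trans (sum_le_sum fun s _ => ?_)
  · have h1 : (rootedSets k m D i).filter (fun S => S.card = s) ⊆ attachedSets k m i s := by
      intro S hS
      rw [mem_filter, mem_rootedSets] at hS
      have := hS.1.2.mem_attachedSets
      rwa [hS.2] at this
    have h2 := (card_le_card h1).trans (card_attachedSets_le i s)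
    exact (Nat.cast_le.2 h2).trans_eq (by push_cast; rfl)
  · have h1 : (2 * m * k + 2 * n * k : ℝ) * (1 / (2 * n)) = m / n * k + k := by field_simp
    have h2 : (m : ℝ) / n ≤ α := by rwa [div_le_iff₀ hn]
    rw [mul_assoc, ← mul_pow, h1]
    gcongr

/-! ### The second moment -/

theorem sq_card_filter_subset {ι : Type*} [DecidableEq ι] (R : Finset (Finset ι))
    (F : Finset ι) :
    ((R.filter (· ⊆ F)).card : ℝ) ^ 2 = ∑ p ∈ R ×ˢ R, if p.1 ∪ p.2 ⊆ F then 1 else 0 := by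
  rw [card_filter, pow_two, sum_product]
  push_cast
  rw [sum_mul_sum]
  refine sum_congr rfl fun S _ => sum_congr rfl fun T _ => ?_
  simp only [union_subset_iff]
  by_cases h1 : S ⊆ F <;> by_cases h2 : T ⊆ F <;> simp [h1, h2]

theorem sum_pairs_rootedSets_le {w : ℝ} (hw : 0 ≤ w) (D : ℕ) (i : Fin n) :
    ∑ p ∈ rootedSets k m D i ×ˢ rootedSets k m D i, w ^ (p.1 ∪ p.2).card ≤
      16 ^ D * ∑ U ∈ rootedSets k m (2 * D) i, w ^ U.card := by
  rw [mul_sum]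
  refine sum_comp_le_of_card_fiber_le (f := fun p => p.1 ∪ p.2)
    (R := rootedSets k m D i ×ˢ rootedSets k m D i) (T := rootedSets k m (2 * D) i)
    (w := fun U => w ^ U.card) (c := fun _ => 16 ^ D) (fun p hp => ?_)
    (fun U => by positivity) fun U hU => ?_
  · obtain ⟨h1, h2⟩ := mem_product.1 hp
    rw [mem_rootedSets] at h1 h2
    exact mem_rootedSets.2 ⟨(card_union_le _ _).trans (by omega), h1.2.union h2.2⟩
  · have h1 : ((rootedSets k m D i ×ˢ rootedSets k m D i).filter fun p => p.1 ∪ p.2 = U) ⊆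
        U.powerset ×ˢ U.powerset := by
      intro p hp
      have := (mem_filter.1 hp).2
      exact mem_product.2 ⟨mem_powerset.2 (this ▸ subset_union_left),
        mem_powerset.2 (this ▸ subset_union_right)⟩
    have h2 := card_le_card h1
    rw [card_product, card_powerset, ← pow_add] at h2
    -- A pair with union `U` consists of two subsets of `U`, and `4^|U| ≤ 4^(2D) = 16^D`.
    have h3 : 2 ^ (U.card + U.card) ≤ 16 ^ D := by
      rw [show 16 = 2 ^ 4 by norm_num, ← pow_mul]
      exact Nat.pow_le_pow_right (by norm_num)
        (by have := (mem_rootedSets.1 hU).1; omega)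
    exact_mod_cast h2.trans h3

theorem integral_card_rootedSets_sq_le [NeZero n] {α : ℝ} (hm : (m : ℝ) ≤ α * n) (D : ℕ)
    (i : Fin n) :
    ∫ Φ, (((rootedSets k m D i).filter (· ⊆ occurrences Φ)).card : ℝ) ^ 2
        ∂(randomFormula k n m) ≤
      16 ^ D * ∑ s ∈ range (2 * D + 1), s.factorial * (α * k + k) ^ s := by
  simp only [sq_card_filter_subset]
  rw [integral_finsetSum _ fun p _ => Integrable.of_finite]
  refine le_trans (sum_le_sum (g := fun p : Finset (InputIndex k n m) × Finset _ =>
    (1 / (2 * n) : ℝ) ^ (p.1 ∪ p.2).card) fun p _ => ?_)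
    ((sum_pairs_rootedSets_le (by positivity) D i).trans ?_)
  · refine le_trans (le_of_eq ?_) (randomFormula_real_subset_occurrences_le (p.1 ∪ p.2))
    rw [← integral_indicator_one (Set.toFinite _).measurableSet]
    simp only [Set.indicator, Set.mem_ofPred_eq, Pi.one_apply]
  · gcongr
    exact sum_rootedSets_le hm _ i

/-! ### Neighborhoods away from variables of high degree -/

/-- The positions of a formula at which a variable from `B` occurs. -/
def incident (Φ : Formula k n m) (B : Finset (Fin n)) : Finset (Fin m × Fin k) :=
  univ.filter fun e => (Φ e.1 e.2).1 ∈ B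

theorem mem_incident {Φ : Formula k n m} {B : Finset (Fin n)} {e : Fin m × Fin k} :
    e ∈ incident Φ B ↔ (Φ e.1 e.2).1 ∈ B := by
  simp [incident]

/-- The variables at distance at most `j` from a variable of degree more than `d`, where variables
that share a clause are at distance one. -/
def nearHighDegree (Φ : Formula k n m) (d : ℕ) : ℕ → Finset (Fin n)
  | 0 => univ.filter fun i => d < (incident Φ {i}).card
  | j + 1 => nearHighDegree Φ d j ∪
      (incident Φ (nearHighDegree Φ d j) ×ˢ univ).image fun p => (Φ p.1.1 p.2).1

theorem card_nearHighDegree_succ_le (Φ : Formula k n m) (d j : ℕ) :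
    (nearHighDegree Φ d (j + 1)).card ≤
      (nearHighDegree Φ d j).card + (incident Φ (nearHighDegree Φ d j)).card * k := by
  rw [nearHighDegree]
  refine (card_union_le _ _).trans ?_
  gcongr
  exact card_image_le.trans_eq (by simp)

theorem nearHighDegree_zero_subset (Φ : Formula k n m) (d j : ℕ) :
    nearHighDegree Φ d 0 ⊆ nearHighDegree Φ d j := by
  induction j with
  | zero => rfl
  | succ j ih =>
    conv_rhs => rw [nearHighDegree]
    exact ih.trans subset_union_left

theorem card_nearHighDegree_zero_mul_le (Φ : Formula k n m) (d : ℕ) :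
    (nearHighDegree Φ d 0).card * (d + 1) ≤ m * k := by
  calc (nearHighDegree Φ d 0).card * (d + 1)
      = ∑ i ∈ nearHighDegree Φ d 0, (d + 1) := by rw [sum_const, smul_eq_mul]
    _ ≤ ∑ i ∈ nearHighDegree Φ d 0, (incident Φ {i}).card :=
        sum_le_sum fun i hi => by
          rw [nearHighDegree, mem_filter] at hi
          exact hi.2
    _ ≤ ∑ i, (incident Φ {i}).card := sum_le_sum_of_subset (subset_univ _)
    _ = m * k := by
        have := card_eq_sum_card_fiberwise (s := (univ : Finset (Fin m × Fin k))) (t := univ)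
          (f := fun e => (Φ e.1 e.2).1) fun _ _ => by simp
        simp only [card_univ, Fintype.card_prod, Fintype.card_fin] at this
        rw [this]
        refine sum_congr rfl fun i _ => ?_
        simp [incident]

/-- The occurrences of literals in a formula that are reached in `j` steps from a variable, where
a step leads from a variable to another one in the same clause. -/
def clauseBall (Φ : Formula k n m) : ℕ → Fin n → Finset (InputIndex k n m)
  | 0, _ => ∅
  | j + 1, i => (incident Φ {i} ×ˢ univ).biUnion fun p =>
      insert (occurrenceAt Φ (p.1.1, p.2)) (clauseBall Φ j (Φ p.1.1 p.2).1)

/-- A bound for the size of `clauseBall` when all degrees are at most `d`. -/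
def clauseBallBound (k d : ℕ) : ℕ → ℕ
  | 0 => 0
  | j + 1 => d * k * (clauseBallBound k d j + 1)

theorem card_clauseBall_le (Φ : Formula k n m) (d j : ℕ) {i : Fin n}
    (hi : i ∉ nearHighDegree Φ d j) : (clauseBall Φ j i).card ≤ clauseBallBound k d j := by
  induction j generalizing i with
  | zero => simp [clauseBall]
  | succ j ih =>
    have hd : (incident Φ {i}).card ≤ d := by
      by_contra h
      exact hi (nearHighDegree_zero_subset Φ d (j + 1) (by simpa [nearHighDegree] using h))
    rw [clauseBall, clauseBallBound]
    refine (card_biUnion_le_card_mul _ _ (clauseBallBound k d j + 1) fun p hp => ?_).trans ?_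
    · refine (card_insert_le _ _).trans ?_
      gcongr
      -- A neighbor of `i` in the `j`-th layer would put its whole clause, hence `i`, into the next
      -- layer.
      refine ih fun h => hi ?_
      rw [mem_product, mem_incident, mem_singleton] at hp
      rw [nearHighDegree]
      refine mem_union_right _ (mem_image.2 ⟨((p.1.1, p.2), p.1.2), ?_, hp.1⟩)
      exact mem_product.2 ⟨mem_incident.2 h, mem_univ _⟩
    · rw [card_product, card_univ, Fintype.card_fin]
      gcongr

theorem BipGraph.IsWalk.of_cons {G : BipGraph} {x y : G.V} {e : G.E} {es : List G.E}
    (h : G.IsWalk x (e :: es) y) :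
    (x = Sum.inl (G.va e) ∧ G.IsWalk (Sum.inr (G.cl e)) es y) ∨
      (x = Sum.inr (G.cl e) ∧ G.IsWalk (Sum.inl (G.va e)) es y) := by
  cases h with
  | consVa _ _ _ h => exact Or.inl ⟨rfl, h⟩
  | consCl _ _ _ h => exact Or.inr ⟨rfl, h⟩

/-- Walks alternate between variables and clauses, so two edges make one step of `clauseBall`: the
first enters a clause, the second leaves it at a variable, where the induction continues. -/
theorem mem_clauseBall_of_isWalk (Φ : Formula k n m) {j : ℕ} {i : Fin n}
    {y : (occurrenceGraph k n m).V} {es : List (InputIndex k n m)}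
    (h : (occurrenceGraph k n m).IsWalk (Sum.inl i) es y) (hl : es.length ≤ 2 * j)
    (hes : ∀ t ∈ es, t ∈ occurrences Φ) : ∀ t ∈ es, t ∈ clauseBall Φ j i := by
  have hocc : ∀ t ∈ occurrences Φ, occurrenceAt Φ (t.1, t.2.1) = t := fun t ht => by
    simp only [occurrenceAt, mem_occurrences.1 ht]
  induction j generalizing i es with
  | zero =>
    rw [List.length_eq_zero_iff.1 (Nat.le_zero.1 hl)]
    simp
  | succ j ih =>
    rw [clauseBall]
    match es, h with
    | [], _ => simp
    | e :: es, h =>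
      obtain ⟨hi, h⟩ | ⟨hi, -⟩ := h.of_cons
      swap
      · cases hi
      replace hi : i = e.2.2.1 := Sum.inl.inj hi
      have he := hes e (by simp)
      have hinc : (e.1, e.2.1) ∈ incident Φ {i} := by
        rw [mem_incident, mem_singleton, mem_occurrences.1 he, hi]
      intro t ht
      rcases List.mem_cons.1 ht with rfl | ht
      · refine mem_biUnion.2 ⟨((t.1, t.2.1), t.2.1), mem_product.2 ⟨hinc, mem_univ _⟩, ?_⟩
        rw [hocc t he]
        exact mem_insert_self _ _
      match es, h with
      | [], _ => simp at ht
      | e' :: es, h =>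
        obtain ⟨hc, -⟩ | ⟨hc, h⟩ := h.of_cons
        · cases hc
        replace hc : e.1 = e'.1 := Sum.inr.inj hc
        have he' := hes e' (by simp)
        refine mem_biUnion.2 ⟨((e.1, e.2.1), e'.2.1), mem_product.2 ⟨hinc, mem_univ _⟩, ?_⟩
        simp only [hc, hocc e' he', mem_occurrences.1 he']
        rcases List.mem_cons.1 ht with rfl | ht
        · exact mem_insert_self _ _
        · refine mem_insert_of_mem (ih h ?_ (fun t ht => hes t (by simp [ht])) t ht)
          simp only [List.length_cons] at hl
          omega

theorem card_nearOccurrences_le (Φ : Formula k n m) (d r : ℕ) {i : Fin n}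
    (hi : i ∉ nearHighDegree Φ d r) :
    (nearOccurrences (occurrences Φ) r i).card ≤ clauseBallBound k d r := by
  refine (card_le_card fun t ht => ?_).trans (card_clauseBall_le Φ d r hi)
  obtain ⟨es, y, hw, hl, hte, hR⟩ := mem_nearOccurrences.1 ht
  exact mem_clauseBall_of_isWalk Φ hw (by omega) (fun t ht => by exact_mod_cast hR t ht) t hte

/-! ### Few variables are close to a variable of high degree -/

theorem randomFormula_real_forall_mem_le [NeZero n] {δ : ℝ} (B : Finset (Fin n))
    (hB : (B.card : ℝ) ≤ δ * n) (I : Finset (Fin m × Fin k)) :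
    (randomFormula k n m).real {Φ | ∀ e ∈ I, (Φ e.1 e.2).1 ∈ B} ≤ δ ^ I.card := by
  have hn : (0 : ℝ) < n := Nat.cast_pos.2 (NeZero.pos n)
  have h := randomFormula_real_forall_mem I fun _ => B ×ˢ (univ : Finset Bool)
  simp only [mem_product, mem_univ, and_true, card_product, card_univ, Fintype.card_bool,
    prod_const] at h
  rw [h]
  gcongr
  push_cast
  rw [div_le_iff₀ (by positivity)]
  linarith

/-- Union bound over pairs of a set `B` of variables and a set `I` of positions. There are at most
`2^(n + mk) ≤ K^n` pairs, and `δ` is chosen such that each has probability at most `δ^(εn) =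
(θ/K)^n`. -/
theorem exists_small_sets_few_incident (k : ℕ) {α ε θ : ℝ} (hα : 0 ≤ α) (hε : 0 < ε)
    (hθ : 0 < θ) (hθ1 : θ ≤ 1) :
    ∃ δ : ℝ, 0 < δ ∧ ∀ (n m : ℕ) [NeZero n], (m : ℝ) ≤ α * n →
      (randomFormula k n m).real {Φ | ∃ B : Finset (Fin n), (B.card : ℝ) ≤ δ * n ∧
        ε * n ≤ (incident Φ B).card} ≤ θ ^ n := by
  set K : ℝ := 2 ^ (1 + α * k) with hK
  have hK1 : 1 ≤ K := Real.one_le_rpow (by norm_num) (by positivity)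
  have hK0 : 0 < K := by positivity
  have hq0 : 0 < θ / K := by positivity
  have hq1 : θ / K ≤ 1 := (div_le_one hK0).2 (hθ1.trans hK1)
  refine ⟨(θ / K) ^ (1 / ε), by positivity, fun n m _ hm => ?_⟩
  set δ := (θ / K) ^ (1 / ε) with hδ
  have hδ0 : 0 < δ := by positivity
  have hδ1 : δ ≤ 1 := Real.rpow_le_one hq0.le hq1 (by positivity)
  have hδn : δ ^ (ε * n) = (θ / K) ^ n := by
    rw [hδ, ← Real.rpow_mul hq0.le, ← Real.rpow_natCast]
    congr 1
    field_simp
  let Q : Finset (Finset (Fin n) × Finset (Fin m × Fin k)) :=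
    univ.filter fun q => (q.1.card : ℝ) ≤ δ * n ∧ ε * n ≤ (q.2.card : ℝ)
  have hQ : (Q.card : ℝ) ≤ K ^ n := by
    have h1 : Q.card ≤ 2 ^ (n + m * k) := by
      refine (card_filter_le _ _).trans_eq ?_
      simp [card_univ, pow_add]
    calc (Q.card : ℝ) ≤ 2 ^ (n + m * k) := by exact_mod_cast h1
      _ = (2 : ℝ) ^ ((n + m * k : ℕ) : ℝ) := (Real.rpow_natCast _ _).symm
      _ ≤ (2 : ℝ) ^ ((1 + α * k) * n) := by
          refine Real.rpow_le_rpow_of_exponent_le (by norm_num) ?_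
          push_cast
          nlinarith [mul_le_mul_of_nonneg_right hm (Nat.cast_nonneg (α := ℝ) k)]
      _ = K ^ n := by rw [Real.rpow_mul (by norm_num), Real.rpow_natCast]
  calc (randomFormula k n m).real {Φ | ∃ B : Finset (Fin n), (B.card : ℝ) ≤ δ * n ∧
        ε * n ≤ (incident Φ B).card}
      ≤ (randomFormula k n m).real (⋃ q ∈ Q, {Φ | ∀ e ∈ q.2, (Φ e.1 e.2).1 ∈ q.1}) := by
        refine measureReal_mono ?_ (measure_ne_top _ _)
        rintro Φ ⟨B, h1, h2⟩
        refine Set.mem_biUnion (x := (B, incident Φ B)) ?_ fun e he => mem_incident.1 he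
        simpa [Q] using ⟨h1, h2⟩
    _ ≤ ∑ q ∈ Q, (randomFormula k n m).real {Φ | ∀ e ∈ q.2, (Φ e.1 e.2).1 ∈ q.1} :=
        measureReal_biUnion_finset_le _ _
    _ ≤ ∑ q ∈ Q, (θ / K) ^ n := by
        refine sum_le_sum fun q hq => ?_
        obtain ⟨-, h1, h2⟩ := mem_filter.1 hq
        refine (randomFormula_real_forall_mem_le q.1 h1 q.2).trans ?_
        rw [← hδn, ← Real.rpow_natCast]
        exact Real.rpow_le_rpow_of_exponent_ge hδ0 hδ1 h2
    _ = Q.card * (θ / K) ^ n := by rw [sum_const, nsmul_eq_mul]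
    _ ≤ K ^ n * (θ / K) ^ n := by gcongr
    _ = θ ^ n := by rw [← mul_pow, mul_div_cancel₀ _ hK0.ne']

/-- Induction on the radius with `ε` free. Radius `0` is deterministic once `d > αk/ε`; each further
step costs one exceptional event of probability at most `θ^n`. -/
theorem exists_degree_nearHighDegree_small {k : ℕ} (hk : 0 < k) {α θ : ℝ} (hα : 0 ≤ α)
    (hθ : 0 < θ) (hθ1 : θ ≤ 1) (j : ℕ) {ε : ℝ} (hε : 0 < ε) :
    ∃ d : ℕ, ∀ (n m : ℕ) [NeZero n], (m : ℝ) ≤ α * n →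
      (randomFormula k n m).real {Φ | ε * n ≤ (nearHighDegree Φ d j).card} ≤ j * θ ^ n := by
  induction j generalizing ε with
  | zero =>
    obtain ⟨d, hd⟩ := exists_nat_gt (α * k / ε)
    refine ⟨d, fun n m _ hm => ?_⟩
    have hn : (0 : ℝ) < n := Nat.cast_pos.2 (NeZero.pos n)
    have : {Φ : Formula k n m | ε * n ≤ (nearHighDegree Φ d 0).card} = ∅ := by
      ext Φ
      simp only [Set.mem_ofPred_eq, Set.mem_empty_iff_false, iff_false, not_le]
      by_contra! h
      have h1 : ((nearHighDegree Φ d 0).card : ℝ) * (d + 1) ≤ m * k := by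
        exact_mod_cast card_nearHighDegree_zero_mul_le Φ d
      have h2 : ε * n * (d + 1) ≤ α * n * k :=
        (mul_le_mul_of_nonneg_right h (by positivity)).trans
          (h1.trans (mul_le_mul_of_nonneg_right hm (by positivity)))
      rw [div_lt_iff₀ hε] at hd
      have h3 : α * k * n < d * ε * n := mul_lt_mul_of_pos_right hd hn
      nlinarith [mul_pos hε hn]
    rw [this]
    simp
  | succ j ih =>
    have hk' : (0 : ℝ) < k := Nat.cast_pos.2 hk
    obtain ⟨δ, hδ, hexp⟩ := exists_small_sets_few_incident k (ε := ε / (2 * k)) hα (by positivity)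
      hθ hθ1
    -- The old layer takes `ε / 2` of the budget. Being below `δ`, it has fewer than `ε n / (2k)`
    -- incidences, whose clauses add less than `ε n / 2` variables.
    obtain ⟨d, hd⟩ := ih (ε := min (ε / 2) δ) (by positivity)
    refine ⟨d, fun n m _ hm => ?_⟩
    have hn : (0 : ℝ) < n := Nat.cast_pos.2 (NeZero.pos n)
    calc (randomFormula k n m).real {Φ | ε * n ≤ (nearHighDegree Φ d (j + 1)).card}
        ≤ (randomFormula k n m).real
            ({Φ | min (ε / 2) δ * n ≤ (nearHighDegree Φ d j).card} ∪
              {Φ | ∃ B : Finset (Fin n), (B.card : ℝ) ≤ δ * n ∧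
                ε / (2 * k) * n ≤ (incident Φ B).card}) := by
          refine measureReal_mono fun Φ hΦ => ?_
          by_contra hn'
          simp only [Set.mem_union, Set.mem_ofPred_eq, not_or, not_le, not_exists, not_and] at hn'
          simp only [Set.mem_ofPred_eq] at hΦ
          obtain ⟨h1, h2⟩ := hn'
          have h3 := h2 (nearHighDegree Φ d j)
            (h1.le.trans (mul_le_mul_of_nonneg_right (min_le_right _ _) hn.le))
          have h4 : ((nearHighDegree Φ d j).card : ℝ) < ε / 2 * n :=
            h1.trans_le (mul_le_mul_of_nonneg_right (min_le_left _ _) hn.le)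
          have h5 : ((nearHighDegree Φ d (j + 1)).card : ℝ) ≤
              (nearHighDegree Φ d j).card + (incident Φ (nearHighDegree Φ d j)).card * k := by
            exact_mod_cast card_nearHighDegree_succ_le Φ d j
          have h6 := mul_lt_mul_of_pos_right h3 hk'
          have h7 : ε / (2 * k) * n * k = ε / 2 * n := by field_simp
          linarith
      _ ≤ j * θ ^ n + θ ^ n := (measureReal_union_le _ _).trans (add_le_add (hd n m hm) (hexp n m hm))
      _ = _ := by push_cast; ring

/-! ### Agreement with the local algorithm and second moment of the polynomial -/

theorem strictRound_ite (b : Bool) : strictRound (if b then 1 else -1) = some b := by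
  cases b <;> norm_num [strictRound]

theorem normHamming_mul_le [NeZero n] {r d D : ℕ} {g : RootedGraph Ω → Bool} (hg : IsLocal r g)
    (hD : clauseBallBound k d r ≤ D) (Φ : Formula k n m) (φ : Node k n m → Ω) :
    normHamming (fun i => some (localAlgorithm g Φ φ i))
      (fun i => strictRound (rulePolynomial g D (encode Φ) φ i)) * n ≤
      (nearHighDegree Φ d r).card := by
  have hn : (n : ℝ) ≠ 0 := Nat.cast_ne_zero.2 (NeZero.ne n)
  rw [normHamming, div_mul_cancel₀ _ hn, Nat.cast_le]
  refine card_le_card fun i hi => ?_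
  by_contra hb
  refine (mem_filter.1 hi).2 ?_
  change some _ = strictRound _
  rw [rulePolynomial_encode_of_card_le hg Φ φ ((card_nearOccurrences_le Φ d r hb).trans hD),
    strictRound_ite]

/-- A bound for the squared norm of the polynomial that does not depend on the rule. -/
noncomputable def normSqBound (D : ℕ) (Φ : Formula k n m) : ℝ :=
  ∑ i, 4 ^ D * (((rootedSets k m D i).filter (· ⊆ occurrences Φ)).card : ℝ) ^ 2

theorem norm_rulePolynomial_sq_le {r : ℕ} {g : RootedGraph Ω → Bool} (hg : IsLocal r g)
    (D : ℕ) (Φ : Formula k n m) (φ : Node k n m → Ω) :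
    ‖rulePolynomial g D (encode Φ) φ‖ ^ 2 ≤ normSqBound D Φ := by
  rw [EuclideanSpace.norm_sq_eq]
  refine sum_le_sum fun i _ => ?_
  rw [Real.norm_eq_abs]
  refine (pow_le_pow_left₀ (abs_nonneg _) (abs_rulePolynomial_encode_le hg D Φ φ i) 2).trans_eq ?_
  rw [mul_pow, ← pow_mul, mul_comm D 2, pow_mul]
  norm_num

theorem integrable_norm_rulePolynomial_sq [NeZero n] [MeasurableSpace Ω] {r : ℕ}
    {g : RootedGraph Ω → Bool} (hg : IsLocal r g) (hgm : IsMeasurableRule g) (D : ℕ)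
    (P' : Measure (Node k n m → Ω)) [IsProbabilityMeasure P'] :
    Integrable (fun q : Formula k n m × (Node k n m → Ω) =>
      ‖rulePolynomial g D (encode q.1) q.2‖ ^ 2) ((randomFormula k n m).prod P') := by
  have hint : Integrable (fun Φ : Formula k n m => normSqBound D Φ) (randomFormula k n m) :=
    Integrable.of_finite
  refine (hint.comp_fst P').mono' ?_ (Filter.Eventually.of_forall fun q => ?_)
  · have hmeas : Measurable fun q : Formula k n m × (Node k n m → Ω) =>
        rulePolynomial g D (encode q.1) q.2 :=
      measurable_from_prod_countable_right fun Φ => measurable_rulePolynomial hgm D (encode Φ)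
    exact (hmeas.norm.pow_const 2).aestronglyMeasurable
  · rw [norm_pow, norm_norm]
    exact norm_rulePolynomial_sq_le hg D q.1 q.2

theorem integral_norm_rulePolynomial_sq_le [NeZero n] [MeasurableSpace Ω] {r : ℕ}
    {g : RootedGraph Ω → Bool} (hg : IsLocal r g) (hgm : IsMeasurableRule g) (D : ℕ)
    (P' : Measure (Node k n m → Ω)) [IsProbabilityMeasure P'] {α : ℝ} (hm : (m : ℝ) ≤ α * n) :
    ∫ q, ‖rulePolynomial g D (encode q.1) q.2‖ ^ 2 ∂((randomFormula k n m).prod P') ≤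
      4 ^ D * (16 ^ D * ∑ s ∈ range (2 * D + 1), s.factorial * (α * k + k) ^ s) * n := by
  have hint : Integrable (fun Φ : Formula k n m => normSqBound D Φ) (randomFormula k n m) :=
    Integrable.of_finite
  calc _ ≤ ∫ q, normSqBound D q.1 ∂((randomFormula k n m).prod P') :=
        integral_mono (integrable_norm_rulePolynomial_sq hg hgm D P') (hint.comp_fst P')
          fun q => norm_rulePolynomial_sq_le hg D q.1 q.2
    _ = ∫ Φ, normSqBound D Φ ∂(randomFormula k n m) := by
        rw [integral_fun_fst (μ := randomFormula k n m) (ν := P') (normSqBound D)]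
        simp
    _ = ∑ i, 4 ^ D * ∫ Φ, (((rootedSets k m D i).filter (· ⊆ occurrences Φ)).card : ℝ) ^ 2
          ∂(randomFormula k n m) := by
        simp only [normSqBound]
        rw [integral_finsetSum _ fun i _ => Integrable.of_finite]
        exact sum_congr rfl fun i _ => integral_const_mul _ _
    _ ≤ ∑ _i : Fin n,
          4 ^ D * (16 ^ D * ∑ s ∈ range (2 * D + 1), s.factorial * (α * k + k) ^ s) := by
        refine sum_le_sum fun i _ => ?_
        gcongr
        exact integral_card_rootedSets_sq_le hm D i
    _ = _ := by
        rw [sum_const, card_univ, Fintype.card_fin, nsmul_eq_mul]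
        ring

/-- Rewrites agreement as an equation between real functions, which makes the error event visibly
measurable. -/
theorem some_eq_strictRound {b : Bool} {x : ℝ} :
    some b = strictRound x ↔ x = if b then 1 else -1 := by
  constructor
  · intro h
    unfold strictRound at h
    split_ifs at h with h1 h2 <;> simp_all
  · rintro rfl
    exact (strictRound_ite b).symm

theorem measurableSet_le_normHamming [MeasurableSpace Ω] {g : RootedGraph Ω → Bool}
    (hgm : IsMeasurableRule g) (D : ℕ) (η : ℝ) :
    MeasurableSet {q : Formula k n m × ((Node k n m → Ω) × (Node k n m → Ω)) |
      η ≤ normHamming (fun i => some (localAlgorithm g q.1 q.2.1 i))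
        (fun i => strictRound (rulePolynomial g D (encode q.1) q.2.2 i))} := by
  refine measurableSet_le measurable_const (measurable_from_prod_countable_right fun Φ => ?_)
  simp only [normHamming, hammingDist, card_filter, Nat.cast_sum]
  refine (Finset.measurable_sum _ fun i _ => ?_).div_const _
  refine measurable_from_top.comp
    (Measurable.ite (MeasurableSet.compl ?_) measurable_const measurable_const)
  simp only [some_eq_strictRound]
  refine measurableSet_eq_fun ?_ (Measurable.ite ?_ measurable_const measurable_const)
  · exact (measurable_pi_apply i).comp ((WithLp.measurable_ofLp 2 _).comp
      ((measurable_rulePolynomial hgm D _).comp measurable_snd))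
  · have h : Measurable fun φ : Node k n m → Ω => localAlgorithm g Φ φ i :=
      hgm (factorGraph Φ) (Sum.inl i) (fun e => (Φ e.1 e.2).2)
        (inferInstanceAs (Finite (Fin n))) (inferInstanceAs (Finite (Fin m)))
        (inferInstanceAs (Finite (Fin m × Fin k)))
    exact (h.comp measurable_fst) (measurableSet_singleton true)

theorem isCoupling_diag {X : Type*} [MeasurableSpace X] (μ : Measure X) :
    IsCoupling (μ.map fun x => (x, x)) μ μ := by
  have h : Measurable fun x : X => (x, x) := measurable_id.prodMk measurable_id
  constructor
  · rw [Measure.map_map measurable_fst h]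
    exact Measure.map_id
  · rw [Measure.map_map measurable_snd h]
    exact Measure.map_id

/-- The factor `(r + 1)^n` absorbs the union over the `r` exceptional events, and `exp(-n)` remains.
-/
theorem natCast_mul_pow_le_exp (r n : ℕ) [NeZero n] :
    (r : ℝ) * (Real.exp (-1) / (r + 1)) ^ n ≤ Real.exp (-(1 * (n : ℝ) ^ (1 / 3 : ℝ))) := by
  have hn : (1 : ℝ) ≤ n := Nat.one_le_cast.2 (NeZero.pos n)
  have h1 : (n : ℝ) ^ (1 / 3 : ℝ) ≤ n := by
    simpa using Real.rpow_le_rpow_of_exponent_le hn (show (1 / 3 : ℝ) ≤ 1 by norm_num)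
  have h2 : (r : ℝ) + 1 ≤ (r + 1) ^ n := le_self_pow₀ (by linarith [Nat.cast_nonneg (α := ℝ) r])
    (NeZero.ne n)
  calc (r : ℝ) * (Real.exp (-1) / (r + 1)) ^ n = r / (r + 1) ^ n * Real.exp (-1) ^ n := by
        rw [div_pow]; ring
    _ ≤ 1 * Real.exp (-1) ^ n := by
        gcongr
        rw [div_le_one (by positivity)]
        linarith
    _ = Real.exp (-n) := by rw [one_mul, ← Real.exp_nat_mul]; ring_nf
    _ ≤ _ := Real.exp_le_exp.2 (by linarith)

end RandomKSat

/-! ### Choice of the constants and the diagonal coupling -/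

open RandomKSat
theorem proposition7p2 (k r : ℕ) (α η : ℝ) (hαk : 2 ≤ α * (k : ℝ)) (hk : 2 ≤ (k : ℝ) - 1)
    (hη : 0 < η) :
    ∃ (D : ℕ) (γ c : ℝ) (n₀ : ℕ), 0 < D ∧ 0 < γ ∧ 0 < c ∧
      ∀ (Ω : Type u) [MeasurableSpace Ω] (P : Measure Ω) [IsProbabilityMeasure P]
        (g : RootedGraph Ω → Bool), IsLocal r g → IsMeasurableRule g →
      ∀ n m : ℕ, m = ⌊α * (n : ℝ)⌋₊ →
        ∃ (Ω' : Type u) (_ : MeasurableSpace Ω') (P' : Measure Ω')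
          (f : (InputIndex k n m → ℝ) → Ω' → EuclideanSpace ℝ (Fin n)),
          IsProbabilityMeasure P' ∧ IsRandomPolynomial D f ∧
          (∃ π : Measure ((Node k n m → Ω) × Ω'),
            IsCoupling π (decorationLaw P k n m) P' ∧
            (n₀ ≤ n →
              ((randomFormula k n m).prod π).real
                {q | η ≤ normHamming (fun i => some (localAlgorithm g q.1 q.2.1 i))
                    (fun i => strictRound (f (encode q.1) q.2.2 i))}
                ≤ Real.exp (-(c * (n : ℝ) ^ (1 / 3 : ℝ))))) ∧
          Integrable (fun q : Formula k n m × Ω' => ‖f (encode q.1) q.2‖ ^ 2)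
            ((randomFormula k n m).prod P') ∧
          ∫ q, ‖f (encode q.1) q.2‖ ^ 2 ∂((randomFormula k n m).prod P') ≤ γ * (n : ℝ) := by
  have hk0 : (0 : ℝ) < k := by linarith
  have hα : 0 < α := pos_of_mul_pos_left (by linarith) hk0.le
  have hθ1 : Real.exp (-1) / ((r : ℝ) + 1) ≤ 1 := by
    rw [div_le_one (by positivity)]
    have : Real.exp (-1) ≤ 1 := Real.exp_le_one_iff.2 (by norm_num)
    linarith [Nat.cast_nonneg (α := ℝ) r]
  obtain ⟨d, hd⟩ := exists_degree_nearHighDegree_small (Nat.cast_pos.1 hk0) hα.le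
    (show 0 < Real.exp (-1) / ((r : ℝ) + 1) by positivity) hθ1 r hη
  -- The `+ 1` only ensures `0 < D`.
  set D := clauseBallBound k d r + 1
  refine ⟨D, 4 ^ D * (16 ^ D * ∑ s ∈ Finset.range (2 * D + 1), s.factorial * (α * k + k) ^ s), 1, 1,
    Nat.succ_pos _, ?_, one_pos, ?_⟩
  · have : (0 : ℝ) < ∑ s ∈ Finset.range (2 * D + 1), s.factorial * (α * k + k) ^ s :=
      Finset.sum_pos (fun s _ => by positivity) ⟨0, by simp⟩
    positivity
  intro Ω _ P _ g hg hgm n m hm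
  have hm' : (m : ℝ) ≤ α * n := hm ▸ Nat.floor_le (by positivity)
  have hP' : IsProbabilityMeasure (decorationLaw P k n m) := by
    unfold decorationLaw; infer_instance
  have hdiag : Measurable fun φ : Node k n m → Ω => (φ, φ) := measurable_id.prodMk measurable_id
  refine ⟨Node k n m → Ω, inferInstance, decorationLaw P k n m, rulePolynomial g D, hP',
    ⟨fun φ => isPolynomialMap_rulePolynomial g D φ, measurable_rulePolynomial hgm D⟩,
    ⟨(decorationLaw P k n m).map fun φ => (φ, φ), isCoupling_diag _, fun hn => ?_⟩, ?_⟩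
  · have : NeZero n := ⟨by omega⟩
    refine le_trans ?_ ((hd n m hm').trans (natCast_mul_pow_le_exp r n))
    have hprod := Measure.map_prod_map (randomFormula k n m) (decorationLaw P k n m)
      measurable_id hdiag
    rw [Measure.map_id] at hprod
    rw [hprod, map_measureReal_apply (measurable_id.prodMap hdiag)
      (measurableSet_le_normHamming hgm D η)]
    -- With shared randomness the error event lies in an event that depends on `Φ` alone.
    refine (measureReal_mono (s₂ := {Φ : Formula k n m | η * n ≤ (nearHighDegree Φ d r).card} ×ˢ
      Set.univ) ?_ (measure_ne_top _ _)).trans_eq ?_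
    · rintro ⟨Φ, φ⟩ hq
      refine ⟨?_, Set.mem_univ _⟩
      exact (mul_le_mul_of_nonneg_right hq (Nat.cast_nonneg n)).trans
        (normHamming_mul_le hg (Nat.le_succ _) Φ φ)
    · rw [measureReal_prod_prod, probReal_univ, mul_one]
  -- The moment bound is claimed for `n = 0` as well, where the norm vanishes; the estimates above
  -- assume `n ≠ 0`.
  · rcases Nat.eq_zero_or_pos n with rfl | hn
    · have h0 : ∀ v : EuclideanSpace ℝ (Fin 0), ‖v‖ ^ 2 = 0 := fun v => by
        rw [Subsingleton.elim v 0]; simp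
      simp only [h0, integral_zero]
      exact ⟨integrable_zero _ _ _, by simp⟩
    · have : NeZero n := ⟨hn.ne'⟩
      exact ⟨integrable_norm_rulePolynomial_sq hg hgm D _,
        integral_norm_rulePolynomial_sq_le hg hgm D _ hm'⟩
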